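/- Let $G$ be a finite-dimensional real Lie group (not assumed connected) with identity $e$ and Lie algebra $\mathfrak g$. Let $A$ be a derivation of $\mathfrak g$, and suppose that $V_1^A=\mathfrak g$, where for $t\in\mathbb R$ $$V_t^A=\mathfrak g\cap\bigoplus_{s\in\mathbb R}E^A_{t+is}$$ and $E^A_\alpha\subset\mathfrak g\otimes\mathbb C$ is the generalized eigenspace of the complexification of $A$ at $\alpha\in\mathbb C$; that is, the whole spectrum of $A$ lies on the line $1+i\mathbb R$. A distance $d:G\times G\to\mathbb R$, not assumed to induce the topology of $G$, is called $A$-homogeneous if it is left-invariant and there is a (continuous) multiplicative one-parameter group $(0,\infty)\to\mathrm{Aut}(G)$, $\lambda\mapsto\delta_\lambda$, of Lie group automorphisms such that, for all $\lambda>0$ and $x,y\in G$, $$(\delta_\lambda)_*=\lambda^A:=e^{(\log\lambda)A}\qquad\text{and}\qquad d(\delta_\lambda x,\delta_\lambda y)=\lambda\,d(x,y).$$ Then every $A$-homogeneous distance $d$ on $G$ is a vector norm. That is, if such a $d$ exists, then $G$ is abelian, the exponential map $\exp:(\mathfrak g,+)\to G$ is an isomorphism of Lie groups, $$d(e,\exp(\lambda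 v))=\lambda\,d(e,\exp v)\qquad\text{for all }\lambda>0,\ v\in\mathfrak g,$$ and there is a norm $\|\cdot\|$ on the real vector space $\mathfrak g$ such that $d(\exp v,\exp w)=\|v-w\|$ for all $v,w\in\mathfrak g$. -/

import Mathlib

open scoped Manifold ContDiff TensorProduct

noncomputable section

/-- A smooth real Lie group has the regularity that Mathlib asks for when it puts the Lie bracket
on the tangent space at the identity. -/
instance lieGroupMinSmoothness {E : Type*} [NormedAddCommGroup E] [NormedSpace ℝ E]
    {G : Type*} [TopologicalSpace G] [ChartedSpace E G] [Group G] [LieGroup 𝓘(ℝ, E) ∞ G] :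
    LieGroup 𝓘(ℝ, E) (minSmoothness ℝ 3) G := by
  rw [minSmoothness_of_isRCLikeNormedField]
  infer_instance

/-- The layer `V_t^A = V ∩ ⨁_{s ∈ ℝ} E^A_{t + i s}` of an endomorphism `A` of a real vector space
`V`: the real vectors that lie, inside the complexification `ℂ ⊗ V`, in the sum of the generalized
eigenspaces of the complexification of `A` at the points of the line `t + i ℝ`. -/
def realLayer {V : Type*} [AddCommGroup V] [Module ℝ V] (A : V →ₗ[ℝ] V) (t : ℝ) :
    Submodule ℝ V :=
  ((⨆ s : ℝ, Module.End.maxGenEigenspace (A.baseChange ℂ) ((t : ℂ) + s * Complex.I) :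
      Submodule ℂ (ℂ ⊗[ℝ] V)).restrictScalars ℝ).comap (TensorProduct.mk ℝ ℂ V 1)

/-- `l ^ A := exp ((log l) A)` for an endomorphism `A` of a finite-dimensional real vector
space. -/
def rpowEnd {E : Type*} [NormedAddCommGroup E] [NormedSpace ℝ E] [FiniteDimensional ℝ E]
    (l : ℝ) (A : E →ₗ[ℝ] E) : E →L[ℝ] E :=
  NormedSpace.exp (Real.log l • LinearMap.toContinuousLinearMap A)

section LieGroup

variable {E : Type*} [NormedAddCommGroup E] [NormedSpace ℝ E] [FiniteDimensional ℝ E]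
  {G : Type*} [TopologicalSpace G] [ChartedSpace E G] [Group G]

/-- `Φ : 𝔤 → G` is the exponential map of `G`: for every `v`, the curve `t ↦ Φ (t v)` is the
integral curve, starting at the identity, of the left-invariant vector field given by `v`. -/
def IsLieExp (Φ : GroupLieAlgebra 𝓘(ℝ, E) G → G) : Prop :=
  Φ 0 = 1 ∧ ∀ v : GroupLieAlgebra 𝓘(ℝ, E) G,
    IsMIntegralCurve (I := 𝓘(ℝ, E)) (fun t : ℝ => Φ (t • v)) (mulInvariantVectorField v)

/-- A left-invariant distance on a group. -/
structure IsLeftInvariantDist {G : Type*} [Group G] (d : G → G → ℝ) : Prop where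
  eq_zero_iff : ∀ x y, d x y = 0 ↔ x = y
  symm : ∀ x y, d x y = d y x
  triangle : ∀ x y z, d x z ≤ d x y + d y z
  left_inv : ∀ g x y, d (g * x) (g * y) = d x y

/-- `δ` is a multiplicative one-parameter group `(0, ∞) → Aut(G)` of Lie group automorphisms with
infinitesimal generator `A`: a group homomorphism with continuous orbits such that each `δ l` is
smooth (so is its inverse `δ l⁻¹`) and `(δ l)_* = l ^ A`. The Lie algebra is the tangent space at
the identity, whose underlying normed space is the model space `E`. -/
structure IsOneParameterGroup (A : GroupLieAlgebra 𝓘(ℝ, E) G →ₗ[ℝ] GroupLieAlgebra 𝓘(ℝ, E) G)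
    (δ : {l : ℝ // 0 < l} →* MulAut G) : Prop where
  continuous_orbit : ∀ p : G, Continuous fun l => δ l p
  smooth : ∀ l, ContMDiff 𝓘(ℝ, E) 𝓘(ℝ, E) ∞ (δ l : G → G)
  differential : ∀ l, ∀ v : E,
    (mfderiv 𝓘(ℝ, E) 𝓘(ℝ, E) (δ l : G → G) 1 : E →L[ℝ] E) v = rpowEnd (E := E) l A v

/-- `d` is an `A`-homogeneous distance: it is left-invariant and there is a multiplicative
one-parameter group of Lie group automorphisms `δ` with generator `A` such that
`d (δ_l x, δ_l y) = l d (x, y)`. The distance is not required to induce the topology of `G`. -/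
structure IsHomogeneousDist (A : GroupLieAlgebra 𝓘(ℝ, E) G →ₗ[ℝ] GroupLieAlgebra 𝓘(ℝ, E) G)
    (d : G → G → ℝ) : Prop where
  dist : IsLeftInvariantDist d
  dilation : ∃ δ : {l : ℝ // 0 < l} →* MulAut G, IsOneParameterGroup A δ ∧
    ∀ l x y, d (δ l x) (δ l y) = l * d x y

end LieGroup

end

/-! Since the spectrum of `A` lies on `1 + iℝ`, `exp (t A)` grows like `exp t` up to a factor `exp
(ε |t|)` with `ε > 0` arbitrary (`growth_of_realLayer`); Jordan blocks and rotations are all that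
can separate it from the scalar `exp t`.

Commutativity comes from a degree count. The differential at the identity of the adjoint
representation is a bilinear map equivariant under the flow. Its values would have to grow at rate 1
as vectors and at rate 2 as products, so it vanishes (`HasUnitGrowth.bilinear_eq_zero`). Hence `Ad`
is trivial along one-parameter subgroups, these commute, and the exponential map is a smooth
homomorphism `Φ` from the vector group. It is a local diffeomorphism at `0`, and the contraction
pushes any kernel element into a neighbourhood where the kernel is trivial, so `Φ` is injective. Its
image is an open and closed subgroup, so each of its cosets is preserved by the dilations, which are
joined to the identity by continuous orbits. Such a coset contains a fixed point of a contraction,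
and the distance allows only the identity as fixed point; so `Φ` is onto.

It remains to treat `N v = d 1 (Φ v)`, which is subadditive but a priori scales only under `exp (t
A)`, not under scalars. Orbits of basis vectors fill an open set, which makes `N` bounded near `0`,
hence continuous. Subadditivity gives `N v ≥ c ‖v‖` on the unit ball, which rules out Jordan growth:
`B = e · exp (-A)` is power bounded. Its determinant has modulus at least one, so some powers of `B`
return to the identity (`exists_pow_tendsto_one`). Along these times the dilations are nearly
scalar, which makes `N` asymptotically homogeneous at scales tending to `0`; subadditivity then
spreads homogeneity to all scales (`IsFlowHomogeneous.map_smul_of_pos`). -/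

/-! ### Growth of the exponential of an operator with spectrum on a vertical line -/

section OperatorExponential

open Filter Topology NormedSpace

/-- An operator intertwiner also intertwines the exponentials. -/
lemma exp_intertwine {E V : Type*} [NormedAddCommGroup E] [NormedSpace ℝ E] [CompleteSpace E]
    [NormedAddCommGroup V] [NormedSpace ℝ V] [NormedSpace ℂ V] [IsScalarTower ℝ ℂ V]
    [CompleteSpace V]
    (J : E →L[ℝ] V) (L : E →L[ℝ] E) (T : V →L[ℂ] V) (h : ∀ v, J (L v) = T (J v)) (v : E) :
    J (exp L v) = exp T (J v) := by
  have h1 := (exp_series_hasSum_exp' (𝕂 := ℝ) L).mapL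
    (J ∘L ContinuousLinearMap.apply ℝ E v)
  have h2 := (exp_series_hasSum_exp' (𝕂 := ℂ) T).mapL
    (ContinuousLinearMap.apply ℂ V (J v))
  have hpow : ∀ n : ℕ, J ((L ^ n) v) = (T ^ n) (J v) := by
    intro n
    induction n with
    | zero => simp
    | succ n ih => rw [pow_succ', pow_succ', mul_apply_eq_comp, h, ih]; rfl
  refine h1.unique ?_
  convert! h2 using 2 with n
  simp only [ContinuousLinearMap.comp_apply, ContinuousLinearMap.apply_apply,
    map_smul, hpow]
  rw [← algebraMap_smul ℂ ((Nat.factorial n : ℝ)⁻¹) ((T ^ n) (J v))]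
  simp

lemma exp_apply_eq_sum_of_pow_apply_eq_zero {𝕜 V : Type*} [RCLike 𝕜] [NormedAddCommGroup V]
    [NormedSpace 𝕜 V] [CompleteSpace V] (N : V →L[𝕜] V) (k : ℕ) (v : V) (h : (N ^ k) v = 0)
    (z : 𝕜) :
    exp (z • N) v = ∑ j ∈ Finset.range k, (z ^ j / (Nat.factorial j : 𝕜)) • (N ^ j) v := by
  have h2 := (exp_series_hasSum_exp' (𝕂 := 𝕜) (z • N)).mapL
    (ContinuousLinearMap.apply 𝕜 V v)
  refine h2.unique ?_
  have : ∀ j ∉ Finset.range k, (ContinuousLinearMap.apply 𝕜 V v)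
      ((Nat.factorial j : 𝕜)⁻¹ • (z • N) ^ j) = 0 := by
    intro j hj
    obtain ⟨i, rfl⟩ := Nat.exists_eq_add_of_le' (not_lt.1 (by simpa using hj))
    have : (N ^ (i + k)) v = 0 := by
      rw [pow_add, mul_apply_eq_comp, h, map_zero]
    simp [smul_pow, this]
  have hsum : HasSum _ _ := hasSum_sum_of_ne_finset_zero this
  convert! hsum using 1
  refine Finset.sum_congr rfl fun j _ => ?_
  simp only [ContinuousLinearMap.apply_apply, smul_pow, smul_apply, smul_smul]
  congr 1
  ring

/-- Trades the polynomial growth of a Jordan block for an arbitrarily small exponential rate. -/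
lemma pow_div_factorial_le_exp_abs {ε : ℝ} (hε : 0 < ε) (j : ℕ) (t : ℝ) :
    |t| ^ j / (Nat.factorial j : ℝ) ≤ (ε⁻¹) ^ j * Real.exp (ε * |t|) := by
  have h := Real.pow_div_factorial_le_exp (ε * |t|) (by positivity) j
  calc |t| ^ j / (Nat.factorial j : ℝ) = (ε⁻¹) ^ j * ((ε * |t|) ^ j / (Nat.factorial j : ℝ)) := by
        rw [mul_pow, mul_div_assoc, ← mul_assoc, ← mul_pow, inv_mul_cancel₀ hε.ne', one_pow, one_mul]
    _ ≤ _ := by gcongr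

/-- On a generalized eigenvector the exponential flow grows subexponentially, up to the modulus of
the exponential of the eigenvalue. -/
lemma growth_of_mem_maxGenEigenspace {V : Type*} [NormedAddCommGroup V] [NormedSpace ℂ V]
    [CompleteSpace V] (T : V →L[ℂ] V) (α : ℂ) (v : V)
    (hv : v ∈ Module.End.maxGenEigenspace (T : V →ₗ[ℂ] V) α) {ε : ℝ} (hε : 0 < ε) :
    ∃ C, ∀ t : ℝ, ‖exp ((t : ℂ) • T) v‖ ≤ C * Real.exp (t * α.re + ε * |t|) := by
  obtain ⟨k, hk⟩ := (Module.End.mem_maxGenEigenspace _ _ _).1 hv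
  let : NormedAlgebra ℚ (V →L[ℂ] V) := .restrictScalars ℚ ℂ _
  set N : V →L[ℂ] V := T - α • 1 with hN
  have hNk : (N ^ k) v = 0 := by
    have : (N ^ k : V →L[ℂ] V) v = (((T : V →ₗ[ℂ] V) - α • (1 : Module.End ℂ V)) ^ k) v := by
      rw [← ContinuousLinearMap.coe_coe, ContinuousLinearMap.toLinearMap_pow]
      rfl
    rw [this, hk]
  refine ⟨∑ j ∈ Finset.range k, (ε⁻¹) ^ j * ‖(N ^ j) v‖, fun t => ?_⟩
  -- Splitting off the scalar `α` leaves `N`, a power of which kills `v`; so `exp (t N) v` is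
  -- polynomial in `t` although `N` itself need not be nilpotent.
  have hT : (t : ℂ) • T = ((t : ℂ) * α) • (1 : V →L[ℂ] V) + (t : ℂ) • N := by
    rw [hN, smul_sub, smul_smul]; abel
  have hexp : exp (((t : ℂ) * α) • (1 : V →L[ℂ] V)) = (Complex.exp (t * α)) • 1 := by
    rw [Complex.exp_eq_exp_ℂ, ← Algebra.algebraMap_eq_smul_one, ← Algebra.algebraMap_eq_smul_one]
    exact (algebraMap_exp_comm _).symm
  rw [hT, exp_add_of_commute ((Commute.one_left _).smul_left _), hexp,
    mul_apply_eq_comp, exp_apply_eq_sum_of_pow_apply_eq_zero N k v hNk]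
  rw [smul_apply, one_apply_eq_self, norm_smul,
    Complex.norm_exp, Real.exp_add, mul_comm, ← mul_assoc, mul_right_comm]
  have hre : ((t : ℂ) * α).re = t * α.re := by simp
  rw [hre]
  gcongr
  rw [Finset.sum_mul]
  refine (norm_sum_le _ _).trans (Finset.sum_le_sum fun j _ => ?_)
  rw [norm_smul, norm_div, norm_pow, Complex.norm_real, Complex.norm_natCast, Real.norm_eq_abs,
    mul_right_comm]
  gcongr
  exact pow_div_factorial_le_exp_abs hε j t

lemma growth_of_mem_iSup_maxGenEigenspace {V : Type*} [NormedAddCommGroup V] [NormedSpace ℂ V]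
    [CompleteSpace V] (T : V →L[ℂ] V) (τ : ℝ) (v : V)
    (hv : v ∈ ⨆ s : ℝ, Module.End.maxGenEigenspace (T : V →ₗ[ℂ] V) ((τ : ℂ) + s * Complex.I))
    {ε : ℝ} (hε : 0 < ε) :
    ∃ C, ∀ t : ℝ, ‖exp ((t : ℂ) • T) v‖ ≤ C * Real.exp (t * τ + ε * |t|) := by
  induction hv using Submodule.iSup_induction' with
  | mem s x hx =>
    obtain ⟨C, hC⟩ := growth_of_mem_maxGenEigenspace T _ x hx hε
    exact ⟨C, by simpa using hC⟩
  | zero => exact ⟨0, by simp⟩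
  | add x y _ _ hx hy =>
    obtain ⟨C, hC⟩ := hx
    obtain ⟨D, hD⟩ := hy
    refine ⟨C + D, fun t => ?_⟩
    rw [map_add, add_mul]
    exact (norm_add_le _ _).trans (add_le_add (hC t) (hD t))

/-- If the spectrum of `A` lies on the line `τ + i ℝ`, then `exp (t A)` grows like `exp (t τ)` up
to subexponential factors. -/
theorem growth_of_realLayer {E : Type*} [NormedAddCommGroup E] [NormedSpace ℝ E]
    [FiniteDimensional ℝ E] (A : E →ₗ[ℝ] E) (τ : ℝ) (hA : realLayer A τ = ⊤) {ε : ℝ}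
    (hε : 0 < ε) :
    ∃ C, 0 < C ∧ ∀ t : ℝ, ‖exp (t • LinearMap.toContinuousLinearMap A)‖ ≤
      C * Real.exp (t * τ + ε * |t|) := by
  have : CompleteSpace E := FiniteDimensional.complete ℝ E
  let b := Module.finBasis ℝ E
  let e : (ℂ ⊗[ℝ] E) ≃ₗ[ℂ] (Fin (Module.finrank ℝ E) → ℂ) := (b.baseChange ℂ).equivFun
  let T' := e.conj (A.baseChange ℂ)
  let T := LinearMap.toContinuousLinearMap T'
  let J' : E →ₗ[ℝ] (Fin (Module.finrank ℝ E) → ℂ) :=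
    (e.toLinearMap.restrictScalars ℝ) ∘ₗ (TensorProduct.mk ℝ ℂ E 1)
  let J := LinearMap.toContinuousLinearMap J'
  have hJ : ∀ v, J v = e (1 ⊗ₜ v) := fun v => rfl
  have hJinj : Function.Injective J' := by
    intro v w hvw
    have h1 : (1 : ℂ) ⊗ₜ[ℝ] v = (1 : ℂ) ⊗ₜ[ℝ] w := e.injective hvw
    apply b.repr.injective
    ext i
    have := congrArg (fun z => (b.baseChange ℂ).repr z i) h1
    simpa using this
  have hT : ∀ w, T (e w) = e (A.baseChange ℂ w) := by
    intro w
    change e.conj (A.baseChange ℂ) (e w) = _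
    simp [LinearEquiv.conj_apply]
  have hpt : ∀ v, ∃ C, ∀ t : ℝ, ‖(Real.exp (t * τ + ε * |t|))⁻¹ •
      exp (t • LinearMap.toContinuousLinearMap A) v‖ ≤ C := by
    intro v
    have hv : (1 : ℂ) ⊗ₜ[ℝ] v ∈ ⨆ s : ℝ, Module.End.maxGenEigenspace (A.baseChange ℂ)
        ((τ : ℂ) + s * Complex.I) := by
      have : v ∈ realLayer A τ := by rw [hA]; trivial
      exact this
    have hJv : J v ∈ ⨆ s : ℝ, Module.End.maxGenEigenspace
        (T : (Fin (Module.finrank ℝ E) → ℂ) →ₗ[ℂ] _) ((τ : ℂ) + s * Complex.I) := by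
      have := Submodule.mem_map_of_mem (f := e.toLinearMap) hv
      rw [Submodule.map_iSup] at this
      refine Set.mem_of_subset_of_mem (SetLike.coe_subset_coe.2 (iSup_mono fun s => ?_)) this
      rintro _ ⟨x, hx, rfl⟩
      obtain ⟨k, hk⟩ := (Module.End.mem_maxGenEigenspace _ _ _).1 hx
      refine (Module.End.mem_maxGenEigenspace _ _ _).2 ⟨k, ?_⟩
      let P : Module.End ℂ (Fin (Module.finrank ℝ E) → ℂ) :=
        (T : _ →ₗ[ℂ] _) - ((τ : ℂ) + s * Complex.I) • (1 : Module.End ℂ _)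
      let Q : Module.End ℂ (ℂ ⊗[ℝ] E) :=
        A.baseChange ℂ - ((τ : ℂ) + s * Complex.I) • (1 : Module.End ℂ _)
      have key : ∀ y, P (e y) = e (Q y) := by
        intro y
        simp only [P, Q, LinearMap.sub_apply, ContinuousLinearMap.coe_coe, hT,
          LinearMap.smul_apply, Module.End.one_apply, map_sub, map_smul]
      have key' : ∀ n : ℕ, ∀ y, (P ^ n) (e y) = e ((Q ^ n) y) := by
        intro n
        induction n with
        | zero => intro y; rfl
        | succ n ih => intro y; rw [pow_succ, Module.End.mul_apply, key, ih, pow_succ,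
            Module.End.mul_apply]
      exact (key' k x).trans (by rw [hk, map_zero])
    obtain ⟨C, hC⟩ := growth_of_mem_iSup_maxGenEigenspace T τ (J v) hJv hε
    obtain ⟨K, -, hK⟩ := LinearMap.exists_antilipschitzWith J' (LinearMap.ker_eq_bot.2 hJinj)
    refine ⟨K * C, fun t => ?_⟩
    have hint : J (exp (t • LinearMap.toContinuousLinearMap A) v) = exp ((t : ℂ) • T) (J v) := by
      apply exp_intertwine
      intro w
      change J (t • A w) = (t : ℂ) • T (J w)
      rw [map_smul, hJ, hJ, hT, LinearMap.baseChange_tmul, Complex.coe_smul]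
    have h1 := hK.le_mul_dist (exp (t • LinearMap.toContinuousLinearMap A) v) 0
    rw [map_zero, dist_zero_right, dist_zero_right] at h1
    rw [norm_smul, norm_inv, Real.norm_of_nonneg (Real.exp_pos _).le,
      inv_mul_le_iff₀ (Real.exp_pos _)]
    calc _ ≤ K * ‖exp ((t : ℂ) • T) (J v)‖ := by rw [← hint]; exact h1
      _ ≤ K * (C * Real.exp (t * τ + ε * |t|)) := by gcongr; exact hC t
      _ = _ := by ring
  -- The constants so far depend on the vector; uniform boundedness over all `t` turns them into one
  -- operator norm bound.
  obtain ⟨C, hC⟩ := banach_steinhaus (g := fun t : ℝ => (Real.exp (t * τ + ε * |t|))⁻¹ •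
      exp (t • LinearMap.toContinuousLinearMap A)) hpt
  refine ⟨max C 1, by positivity, fun t => ?_⟩
  have := hC t
  rw [norm_smul, norm_inv, Real.norm_of_nonneg (Real.exp_pos _).le,
      inv_mul_le_iff₀ (Real.exp_pos _), mul_comm] at this
  exact this.trans (by gcongr; exact le_max_left _ _)

end OperatorExponential

/-! ### Flows of unit growth, determinants and recurrence -/

section DilationFlow

open Filter Topology NormedSpace

variable {E : Type*} [NormedAddCommGroup E] [NormedSpace ℝ E]

/-- The flow `exp (t L)` grows like `exp t`, up to subexponential factors. -/
def HasUnitGrowth (L : E →L[ℝ] E) : Prop :=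
  ∀ ε : ℝ, 0 < ε → ∃ C, 0 < C ∧ ∀ t : ℝ, ‖exp (t • L)‖ ≤ C * Real.exp (t + ε * |t|)

lemma hasUnitGrowth_of_realLayer [FiniteDimensional ℝ E] (A : E →ₗ[ℝ] E)
    (hA : realLayer A 1 = ⊤) : HasUnitGrowth (LinearMap.toContinuousLinearMap A) := by
  intro ε hε
  simpa using growth_of_realLayer A 1 hA hε

lemma exp_add_smul [CompleteSpace E] (L : E →L[ℝ] E) (s t : ℝ) :
    exp ((s + t) • L) = exp (s • L) * exp (t • L) := by
  let : NormedAlgebra ℚ (E →L[ℝ] E) := .restrictScalars ℚ ℝ _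
  rw [add_smul]
  exact exp_add_of_commute (((Commute.refl L).smul_left s).smul_right t)

lemma exp_neg_smul_mul_exp_smul [CompleteSpace E] (L : E →L[ℝ] E) (t : ℝ) :
    exp ((-t) • L) * exp (t • L) = 1 := by
  rw [← exp_add_smul, neg_add_cancel, zero_smul, exp_zero]

lemma exp_smul_mul_exp_neg_smul [CompleteSpace E] (L : E →L[ℝ] E) (t : ℝ) :
    exp (t • L) * exp ((-t) • L) = 1 := by
  rw [← exp_add_smul, add_neg_cancel, zero_smul, exp_zero]

lemma exp_natCast_mul_smul [CompleteSpace E] (L : E →L[ℝ] E) (n : ℕ) (t : ℝ) :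
    exp (((n : ℝ) * t) • L) = exp (t • L) ^ n := by
  induction n with
  | zero => simp
  | succ n ih => rw [Nat.cast_succ, add_mul, one_mul, exp_add_smul, ih, pow_succ]

lemma HasUnitGrowth.tendsto_zero {L : E →L[ℝ] E} (hL : HasUnitGrowth L) :
    Tendsto (fun t : ℝ => exp (t • L)) atBot (𝓝 0) := by
  obtain ⟨C, -, hC⟩ := hL (1 / 2) (by norm_num)
  have h1 : Tendsto (fun t : ℝ => C * Real.exp (t / 2)) atBot (𝓝 0) := by
    simpa using (Real.tendsto_exp_atBot.comp
      (tendsto_id.atBot_div_const (by norm_num : (0 : ℝ) < 2))).const_mul C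
  refine squeeze_zero_norm' ?_ h1
  filter_upwards [eventually_le_atBot 0] with t ht
  refine (hC t).trans (le_of_eq ?_)
  rw [abs_of_nonpos ht]
  ring_nf

/-- A vector of the kernel is fixed by the flow, which contracts it to `0` as `t → -∞`. -/
lemma HasUnitGrowth.injective [CompleteSpace E] {L : E →L[ℝ] E} (hL : HasUnitGrowth L) :
    Function.Injective L := by
  refine (injective_iff_map_eq_zero L).2 fun v hv => ?_
  have h1 : ∀ t : ℝ, exp (t • L) v = v := fun t => by
    rw [exp_apply_eq_sum_of_pow_apply_eq_zero L 1 v (by simpa using hv)]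
    simp
  have h2 : Tendsto (fun t : ℝ => exp (t • L) v) atBot (𝓝 0) := by
    simpa [Function.comp_def] using
      ((ContinuousLinearMap.apply ℝ E v).continuous.tendsto 0).comp hL.tendsto_zero
  simp only [h1] at h2
  exact tendsto_nhds_unique tendsto_const_nhds h2

lemma ContinuousLinearMap.det_pow (B : E →L[ℝ] E) (n : ℕ) : (B ^ n).det = B.det ^ n := by
  change LinearMap.det ((B ^ n : E →L[ℝ] E) : E →ₗ[ℝ] E) = LinearMap.det (B : E →ₗ[ℝ] E) ^ n
  rw [ContinuousLinearMap.toLinearMap_pow, map_pow]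

lemma ContinuousLinearMap.isUnit_of_det_ne_zero [FiniteDimensional ℝ E] (T : E →L[ℝ] E)
    (hT : T.det ≠ 0) : IsUnit T := by
  have : CompleteSpace E := FiniteDimensional.complete ℝ E
  have := (LinearMap.isUnit_iff_isUnit_det (T : E →ₗ[ℝ] E)).2 (isUnit_iff_ne_zero.2 hT)
  exact ContinuousLinearMap.isUnit_iff_bijective.2 ((Module.End.isUnit_iff _).1 this)

/-- The determinant is continuous, hence bounded on the compact unit ball, and homogeneous of degree
the dimension. -/
lemma exists_abs_det_le_mul_norm_pow [FiniteDimensional ℝ E] :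
    ∃ K : ℝ, ∀ T : E →L[ℝ] E, |T.det| ≤ K * ‖T‖ ^ Module.finrank ℝ E := by
  have : ProperSpace (E →L[ℝ] E) := FiniteDimensional.proper ℝ _
  obtain ⟨K, hK⟩ := (isCompact_closedBall (0 : E →L[ℝ] E) 1).exists_bound_of_continuousOn
    (f := fun T => T.det) ContinuousLinearMap.continuous_det.continuousOn
  refine ⟨K, fun T => ?_⟩
  have hdet : ∀ (c : ℝ) (T : E →L[ℝ] E), (c • T).det = c ^ Module.finrank ℝ E * T.det :=
    fun c T => LinearMap.det_smul c (T : E →ₗ[ℝ] E)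
  rcases eq_or_ne T 0 with rfl | hT
  · rcases Nat.eq_zero_or_pos (Module.finrank ℝ E) with h | h
    · simpa [h] using hK 0 (by simp)
    · have := hdet 0 0
      rw [zero_smul, zero_pow h.ne', zero_mul] at this
      simp [this, h.ne']
  · have hpos := norm_pos_iff.2 hT
    have h1 := hK (‖T‖⁻¹ • T) (by simp [norm_smul, hpos.ne'])
    rw [hdet, Real.norm_eq_abs, abs_mul, abs_pow, abs_inv, abs_norm, inv_pow,
      inv_mul_le_iff₀ (by positivity)] at h1
    linarith

/-- An endomorphism whose powers grow subexponentially has determinant of modulus at most one. -/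
lemma abs_det_le_one_of_subexponential [FiniteDimensional ℝ E] (T : E →L[ℝ] E)
    (hT : ∀ ε : ℝ, 0 < ε → ∃ C, 0 < C ∧ ∀ n : ℕ, ‖T ^ n‖ ≤ C * Real.exp (ε * n)) :
    |T.det| ≤ 1 := by
  by_contra! h
  obtain ⟨K, hK⟩ := exists_abs_det_le_mul_norm_pow (E := E)
  set d := Module.finrank ℝ E
  have hlog := Real.log_pos h
  -- The denominator `d + 1` leaves one spare factor: `|det T|` is `exp ε` times the `d`-th power of
  -- `exp ε`, so after cancelling the norm bound `exp (ε n)` is still unbounded.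
  set ε := Real.log |T.det| / (d + 1) with hε
  obtain ⟨C, hC0, hC⟩ := hT ε (by positivity)
  have hle : ∀ n : ℕ, Real.exp ε ^ n ≤ |K| * C ^ d := by
    intro n
    have h1 : |T.det| ^ n ≤ |K| * (C * Real.exp (ε * n)) ^ d := by
      rw [← abs_pow, ← T.det_pow]
      refine (hK _).trans ?_
      have := hC n
      have := le_abs_self K
      gcongr
    have h2 : |T.det| ^ n = Real.exp ε ^ n * Real.exp (ε * n) ^ d := by
      rw [← Real.exp_log (show 0 < |T.det| by linarith), ← Real.exp_nat_mul, ← Real.exp_nat_mul,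
        ← Real.exp_nat_mul, ← Real.exp_add]
      congr 1
      have : Real.log |T.det| = ε * (d + 1) := by rw [hε]; field_simp
      rw [this]; ring
    rw [h2, mul_pow, ← mul_assoc] at h1
    exact le_of_mul_le_mul_right h1 (by positivity)
  have := tendsto_pow_atTop_atTop_of_one_lt (Real.one_lt_exp_iff.2 (by positivity : 0 < ε))
  obtain ⟨n, hn⟩ := (this.eventually_gt_atTop (|K| * C ^ d)).exists
  exact absurd (hle n) (not_le.2 hn)

/-- A power bounded endomorphism whose determinant has modulus at least one is recurrent. -/
lemma exists_pow_tendsto_one [FiniteDimensional ℝ E] (B : E →L[ℝ] E) (hdet : 1 ≤ |B.det|)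
    (hB : ∃ K, ∀ n : ℕ, ‖B ^ n‖ ≤ K) :
    ∃ m : ℕ → ℕ, Tendsto m atTop atTop ∧ Tendsto (fun k => B ^ m k) atTop (𝓝 1) := by
  have : ProperSpace (E →L[ℝ] E) := FiniteDimensional.proper ℝ _
  obtain ⟨K, hK⟩ := hB
  obtain ⟨P, -, φ, hφ, hlim⟩ := (isCompact_closedBall (0 : E →L[ℝ] E) K).tendsto_subseq
    (x := fun n => B ^ n) (fun n => by simpa using hK n)
  -- The limit `P` of a convergent subsequence of powers inherits `|det P| ≥ 1`, so quotients of
  -- powers along it tend to `P P⁻¹ = 1`.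
  have hP : IsUnit P := by
    apply P.isUnit_of_det_ne_zero
    have h1 := ((ContinuousLinearMap.continuous_det (E := E)).abs.tendsto P).comp hlim
    have : (1 : ℝ) ≤ |P.det| := by
      refine ge_of_tendsto' h1 fun n => ?_
      simp only [Function.comp, B.det_pow, abs_pow]
      exact one_le_pow₀ hdet
    intro h
    rw [h] at this
    norm_num at this
  have hBu : IsUnit B := B.isUnit_of_det_ne_zero fun h => by rw [h] at hdet; norm_num at hdet
  have hinv : Tendsto (fun k => Ring.inverse (B ^ φ k)) atTop (𝓝 (Ring.inverse P)) := by
    obtain ⟨u, rfl⟩ := hP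
    exact (NormedRing.inverse_continuousAt u).tendsto.comp hlim
  have hj : Tendsto (fun k => φ k + k) atTop atTop :=
    tendsto_atTop_mono (fun k => Nat.le_add_left k (φ k)) tendsto_id
  -- Comparing with the index `φ k + k` makes the difference of exponents at least `k`, as `φ n ≥
  -- n`.
  refine ⟨fun k => φ (φ k + k) - φ k, ?_, ?_⟩
  · refine tendsto_atTop_mono (fun k => ?_) tendsto_id
    have := hφ.le_apply (x := φ k + k)
    simp only [id]
    omega
  · have h2 : Tendsto (fun k => B ^ φ (φ k + k) * Ring.inverse (B ^ φ k)) atTop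
        (𝓝 (P * Ring.inverse P)) := (hlim.comp hj).mul hinv
    rw [Ring.mul_inverse_cancel _ hP] at h2
    refine h2.congr fun k => ?_
    have hle : φ k ≤ φ (φ k + k) := hφ.monotone (by omega)
    obtain ⟨i, hi⟩ := Nat.exists_eq_add_of_le' hle
    change _ = B ^ (φ (φ k + k) - φ k)
    rw [hi, Nat.add_sub_cancel, pow_add, mul_assoc, Ring.mul_inverse_cancel _ (hBu.pow _), mul_one]

end DilationFlow

/-! ### From homogeneity under the flow to a norm -/

section HomogeneousNorm

open Filter Topology NormedSpace

variable {E : Type*} [NormedAddCommGroup E] [NormedSpace ℝ E]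

/-- A subadditive, even, positive definite function which is multiplied by `exp t` under the flow
`exp (t L)`. -/
structure IsFlowHomogeneous (L : E →L[ℝ] E) (N : E → ℝ) : Prop where
  eq_zero_iff : ∀ v, N v = 0 ↔ v = 0
  neg : ∀ v, N (-v) = N v
  add_le : ∀ v w, N (v + w) ≤ N v + N w
  flow : ∀ (t : ℝ) v, N (exp (t • L) v) = Real.exp t * N v

namespace IsFlowHomogeneous

variable {L : E →L[ℝ] E} {N : E → ℝ}

lemma map_zero (hN : IsFlowHomogeneous L N) : N 0 = 0 := (hN.eq_zero_iff 0).2 rfl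

lemma nonneg (hN : IsFlowHomogeneous L N) (v : E) : 0 ≤ N v := by
  have := hN.add_le v (-v)
  rw [add_neg_cancel, hN.map_zero, hN.neg] at this
  linarith

lemma sub_le (hN : IsFlowHomogeneous L N) (v w : E) : N (v - w) ≤ N v + N w := by
  rw [sub_eq_add_neg, ← hN.neg w]
  exact hN.add_le _ _

lemma sum_le (hN : IsFlowHomogeneous L N) {ι : Type*} (s : Finset ι) (f : ι → E) :
    N (∑ i ∈ s, f i) ≤ ∑ i ∈ s, N (f i) :=
  Finset.le_sum_of_subadditive N hN.map_zero.le hN.add_le s f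

lemma nsmul_le (hN : IsFlowHomogeneous L N) (n : ℕ) (v : E) :
    N ((n : ℝ) • v) ≤ n * N v := by
  have := hN.sum_le (Finset.range n) fun _ => v
  simpa [← Nat.cast_smul_eq_nsmul ℝ] using this

/-- The combined orbits of the vectors of a basis fill an open set, so a flow-homogeneous function
is bounded near the origin. -/
lemma exists_eventually_le [FiniteDimensional ℝ E] (hL : HasUnitGrowth L)
    (hN : IsFlowHomogeneous L N) : ∃ C, ∀ᶠ v in 𝓝 (0 : E), N v ≤ C := by
  have : CompleteSpace E := FiniteDimensional.complete ℝ E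
  let b := Module.finBasis ℝ E
  -- The derivative of `f` at `0` sends `s` to `∑ s i • L (b i)`, which is onto because `L` is
  -- bijective; so `f` maps a ball onto a neighbourhood of `f 0`, on which flow homogeneity and
  -- subadditivity bound `N`.
  let f : (Fin (Module.finrank ℝ E) → ℝ) → E := fun s => ∑ i, exp (s i • L) (b i)
  let f' : (Fin (Module.finrank ℝ E) → ℝ) →L[ℝ] E :=
    ∑ i, (ContinuousLinearMap.proj i : (Fin (Module.finrank ℝ E) → ℝ) →L[ℝ] ℝ).smulRight (L (b i))
  have hf : HasStrictFDerivAt f f' 0 := by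
    refine HasStrictFDerivAt.fun_sum fun i _ => ?_
    have h1 : HasStrictDerivAt (fun u : ℝ => exp (u • L) (b i)) (L (b i)) 0 := by
      have := (ContinuousLinearMap.apply ℝ E (b i)).hasStrictFDerivAt.comp_hasStrictDerivAt
        (0 : ℝ) (hasStrictDerivAt_exp_smul_const L (0 : ℝ))
      simpa [Function.comp_def] using this
    have h2 := HasStrictFDerivAt.comp (0 : Fin (Module.finrank ℝ E) → ℝ)
      (f := fun s : Fin (Module.finrank ℝ E) → ℝ => s i) h1.hasStrictFDerivAt
      (ContinuousLinearMap.proj i : (Fin (Module.finrank ℝ E) → ℝ) →L[ℝ] ℝ).hasStrictFDerivAt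
    refine h2.congr_fderiv ?_
    ext s
    simp
  have hsurj : f'.range = ⊤ := by
    refine LinearMap.range_eq_top.2 fun v => ?_
    obtain ⟨w, rfl⟩ := (LinearMap.injective_iff_surjective (f := (L : E →ₗ[ℝ] E))).1 hL.injective v
    refine ⟨b.repr w, ?_⟩
    have := congrArg L (b.sum_repr w)
    simpa only [map_sum, map_smul, f', ContinuousLinearMap.coe_coe, sum_apply,
      ContinuousLinearMap.smulRight_apply, ContinuousLinearMap.proj_apply] using this
  have hmap := hf.map_nhds_eq_of_surj hsurj
  have hball : Metric.ball (0 : Fin (Module.finrank ℝ E) → ℝ) 1 ∈ 𝓝 0 :=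
    Metric.ball_mem_nhds _ one_pos
  have himg : f '' Metric.ball 0 1 ∈ 𝓝 (f 0) := hmap ▸ image_mem_map hball
  have hbound : ∀ s ∈ Metric.ball (0 : Fin (Module.finrank ℝ E) → ℝ) 1,
      N (f s) ≤ ∑ i, Real.exp 1 * N (b i) := by
    intro s hs
    refine (hN.sum_le _ _).trans (Finset.sum_le_sum fun i _ => ?_)
    rw [hN.flow]
    have h1 := norm_le_pi_norm s i
    have h2 : ‖s‖ < 1 := by simpa using hs
    have h3 := le_abs_self (s i)
    rw [Real.norm_eq_abs] at h1
    have := hN.nonneg (b i)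
    gcongr
    linarith
  -- The neighbourhood is centred at `f 0`; moving it to the origin costs `N (f 0)`.
  refine ⟨∑ i, Real.exp 1 * N (b i) + N (f 0), ?_⟩
  have htend : Tendsto (fun v => f 0 + v) (𝓝 0) (𝓝 (f 0)) := by
    have : Continuous fun v => f 0 + v := by fun_prop
    simpa using this.tendsto 0
  filter_upwards [htend himg] with v hv
  obtain ⟨s, hs, hsv⟩ := hv
  change f s = f 0 + v at hsv
  have h1 := hN.sub_le (f 0 + v) (f 0)
  rw [add_sub_cancel_left, ← hsv] at h1
  linarith [hbound s hs]

lemma tendsto_zero [FiniteDimensional ℝ E] (hL : HasUnitGrowth L)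
    (hN : IsFlowHomogeneous L N) : Tendsto N (𝓝 0) (𝓝 0) := by
  have : CompleteSpace E := FiniteDimensional.complete ℝ E
  obtain ⟨C, hC⟩ := hN.exists_eventually_le hL
  have hC0 : 0 ≤ C := by simpa [hN.map_zero] using hC.self_of_nhds
  rw [Metric.tendsto_nhds]
  intro η hη
  -- Near `0` the vector flowed by `-t` is still in the region where `N ≤ C`, so `N v ≤ exp t * C <
  -- η`; the `+ 1` covers `C = 0`.
  set t := Real.log (η / (C + 1)) with ht
  have hexp : Real.exp t = η / (C + 1) := Real.exp_log (by positivity)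
  have hcont : Tendsto (fun v => exp ((-t) • L) v) (𝓝 0) (𝓝 0) := by
    simpa using (exp ((-t) • L)).continuous.tendsto 0
  filter_upwards [hcont.eventually hC] with v hv
  have hv' : exp (t • L) (exp ((-t) • L) v) = v := by
    rw [← mul_apply_eq_comp, exp_smul_mul_exp_neg_smul, one_apply_eq_self]
  rw [Real.dist_eq, sub_zero, abs_of_nonneg (hN.nonneg v), ← hv', hN.flow, hexp, div_mul_eq_mul_div,
    div_lt_iff₀ (by positivity)]
  nlinarith

lemma continuous [FiniteDimensional ℝ E] (hL : HasUnitGrowth L)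
    (hN : IsFlowHomogeneous L N) : Continuous N := by
  refine continuous_iff_continuousAt.2 fun v => ?_
  have h0 : Tendsto (fun w => N (w - v)) (𝓝 v) (𝓝 0) := by
    refine (hN.tendsto_zero hL).comp ?_
    have : Continuous fun w => w - v := by fun_prop
    simpa using this.tendsto v
  refine tendsto_iff_dist_tendsto_zero.2 (squeeze_zero (fun _ => dist_nonneg) (fun w => ?_) h0)
  rw [Real.dist_eq, abs_sub_le_iff]
  have h1 := hN.add_le (w - v) v
  have h2 := hN.sub_le w (w - v)
  rw [sub_add_cancel] at h1
  rw [sub_sub_cancel] at h2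
  constructor <;> linarith

/-- On the compact shell `1 ≤ ‖v‖ ≤ 2` continuity and definiteness bound `N` below. A shorter vector
enters the shell after multiplication by an integer `n` with `n ‖v‖ ≤ 2`, and `N (n v) ≤ n N v`
transfers the bound. -/
lemma exists_mul_norm_le [FiniteDimensional ℝ E] (hL : HasUnitGrowth L)
    (hN : IsFlowHomogeneous L N) : ∃ c, 0 < c ∧ ∀ v, ‖v‖ ≤ 1 → c * ‖v‖ ≤ N v := by
  have : ProperSpace E := FiniteDimensional.proper ℝ E
  let K : Set E := {v | 1 ≤ ‖v‖} ∩ Metric.closedBall 0 2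
  have hK : IsCompact K :=
    (isCompact_closedBall (0 : E) 2).inter_left (isClosed_le continuous_const continuous_norm)
  have hc : ∃ c, 0 < c ∧ ∀ v ∈ K, c ≤ N v := by
    -- The shell is empty when the space is trivial.
    rcases K.eq_empty_or_nonempty with h | h
    · exact ⟨1, one_pos, by simp [h]⟩
    · obtain ⟨v, hv, hmin⟩ := hK.exists_isMinOn h (hN.continuous hL).continuousOn
      refine ⟨N v, lt_of_le_of_ne (hN.nonneg v) fun h0 => ?_, hmin⟩
      have : v = 0 := (hN.eq_zero_iff v).1 h0.symm
      have h1 : 1 ≤ ‖v‖ := hv.1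
      rw [this, norm_zero] at h1
      norm_num at h1
  obtain ⟨c, hc0, hc⟩ := hc
  refine ⟨c / 2, by positivity, fun v hv => ?_⟩
  rcases eq_or_ne v 0 with rfl | hv0
  · simp [hN.map_zero]
  have hpos := norm_pos_iff.2 hv0
  have hn1 := Nat.le_ceil (‖v‖⁻¹)
  have hn2 := Nat.ceil_lt_add_one (inv_nonneg.2 hpos.le)
  set n := ⌈‖v‖⁻¹⌉₊
  have h1 : 1 ≤ (n : ℝ) * ‖v‖ := by
    calc 1 = ‖v‖⁻¹ * ‖v‖ := (inv_mul_cancel₀ hpos.ne').symm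
      _ ≤ _ := by gcongr
  have h2 : (n : ℝ) * ‖v‖ ≤ 2 := by
    calc (n : ℝ) * ‖v‖ ≤ (‖v‖⁻¹ + 1) * ‖v‖ := by gcongr
      _ = 1 + ‖v‖ := by rw [add_mul, inv_mul_cancel₀ hpos.ne', one_mul]
      _ ≤ 2 := by linarith
  have h3 : c ≤ N ((n : ℝ) • v) := by
    apply hc
    constructor
    · simpa [norm_smul] using h1
    · simpa [norm_smul] using h2
  have h4 := hN.nsmul_le n v
  have hn : 0 < (n : ℝ) := by
    by_contra! h
    nlinarith
  have h5 : c * ‖v‖ ≤ 2 * N v := by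
    have : (n : ℝ) * (c * ‖v‖) ≤ n * (2 * N v) := by
      nlinarith
    exact le_of_mul_le_mul_left this hn
  linarith

/-- Once `exp (-n L) v` has entered the unit ball, `c ‖exp (-n L) v‖ ≤ exp (-n) N v`; multiplying by
`exp n` bounds the `n`-th power at `v`. The finitely many earlier powers are absorbed in a sum, and
uniform boundedness does the rest. -/
lemma exists_pow_le [FiniteDimensional ℝ E] (hL : HasUnitGrowth L)
    (hN : IsFlowHomogeneous L N) :
    ∃ K, ∀ n : ℕ, ‖(Real.exp 1 • exp ((-1 : ℝ) • L)) ^ n‖ ≤ K := by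
  have : CompleteSpace E := FiniteDimensional.complete ℝ E
  obtain ⟨c, hc0, hc⟩ := hN.exists_mul_norm_le hL
  refine banach_steinhaus fun v => ?_
  have hpow : ∀ n : ℕ, (Real.exp 1 • exp ((-1 : ℝ) • L)) ^ n =
      Real.exp n • exp ((-(n : ℝ)) • L) := by
    intro n
    rw [smul_pow, ← exp_natCast_mul_smul, ← Real.exp_nat_mul]
    simp
  have htend : Tendsto (fun n : ℕ => exp ((-(n : ℝ)) • L) v) atTop (𝓝 0) := by
    have h1 : Tendsto (fun n : ℕ => -(n : ℝ)) atTop atBot :=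
      tendsto_neg_atTop_atBot.comp tendsto_natCast_atTop_atTop
    simpa [Function.comp_def] using
      ((ContinuousLinearMap.apply ℝ E v).continuous.tendsto 0).comp (hL.tendsto_zero.comp h1)
  have hev : ∀ᶠ n : ℕ in atTop, ‖exp ((-(n : ℝ)) • L) v‖ ≤ 1 := by
    filter_upwards [htend (Metric.closedBall_mem_nhds 0 one_pos)] with n hn
    simpa using hn
  obtain ⟨n₀, hn₀⟩ := eventually_atTop.1 hev
  refine ⟨N v / c + ∑ i ∈ Finset.range n₀, ‖((Real.exp 1 • exp ((-1 : ℝ) • L)) ^ i) v‖,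
    fun n => ?_⟩
  have hNv : 0 ≤ N v / c := div_nonneg (hN.nonneg v) hc0.le
  rcases lt_or_ge n n₀ with h | h
  · have := Finset.single_le_sum
      (f := fun i => ‖((Real.exp 1 • exp ((-1 : ℝ) • L)) ^ i) v‖) (fun _ _ => norm_nonneg _)
      (Finset.mem_range.2 h)
    linarith
  · have h1 := hc _ (hn₀ n h)
    rw [hN.flow, Real.exp_neg, le_inv_mul_iff₀ (Real.exp_pos _)] at h1
    have h2 : ‖((Real.exp 1 • exp ((-1 : ℝ) • L)) ^ n) v‖ ≤ N v / c := by
      rw [hpow, smul_apply, norm_smul, Real.norm_of_nonneg (Real.exp_pos _).le, le_div_iff₀ hc0]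
      linarith
    have h3 : 0 ≤ ∑ i ∈ Finset.range n₀, ‖((Real.exp 1 • exp ((-1 : ℝ) • L)) ^ i) v‖ :=
      Finset.sum_nonneg fun _ _ => norm_nonneg _
    linarith

/-- There are scales `l k → 0` at which `N` is asymptotically homogeneous. -/
lemma exists_scales [FiniteDimensional ℝ E] (hL : HasUnitGrowth L)
    (hN : IsFlowHomogeneous L N) :
    ∃ l : ℕ → ℝ, (∀ k, 0 < l k) ∧ Tendsto l atTop (𝓝 0) ∧
      ∀ v, Tendsto (fun k => N (l k • v) / l k) atTop (𝓝 (N v)) := by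
  have : CompleteSpace E := FiniteDimensional.complete ℝ E
  set B := Real.exp 1 • exp ((-1 : ℝ) • L) with hB
  set B' := Real.exp (-1) • exp ((1 : ℝ) • L) with hB'
  have hpow : ∀ n : ℕ, B ^ n = Real.exp n • exp ((-(n : ℝ)) • L) := by
    intro n
    rw [hB, smul_pow, ← exp_natCast_mul_smul, ← Real.exp_nat_mul]
    simp
  have hpow' : ∀ n : ℕ, B' ^ n = Real.exp (-n) • exp ((n : ℝ) • L) := by
    intro n
    rw [hB', smul_pow, ← exp_natCast_mul_smul, ← Real.exp_nat_mul]
    simp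
  have hinv : B' * B = 1 := by
    rw [hB, hB', smul_mul_smul_comm, exp_smul_mul_exp_neg_smul, ← Real.exp_add]
    simp
  -- Unit growth with arbitrary `ε` makes the powers of `B'` subexponential; as `B' B = 1`, this
  -- bounds `|det B|` from below, as recurrence requires.
  have hdet' : |B'.det| ≤ 1 := by
    apply abs_det_le_one_of_subexponential
    intro ε hε
    obtain ⟨C, hC0, hC⟩ := hL ε hε
    refine ⟨C, hC0, fun n => ?_⟩
    rw [hpow', norm_smul, Real.norm_of_nonneg (Real.exp_pos _).le, Real.exp_neg,
      inv_mul_le_iff₀ (Real.exp_pos _)]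
    refine (hC n).trans (le_of_eq ?_)
    rw [Nat.abs_cast, Real.exp_add]
    ring
  have hdet : 1 ≤ |B.det| := by
    have h1 : B'.det * B.det = 1 := by
      have : (B' * B).det = B'.det * B.det :=
        LinearMap.det_comp (B' : E →ₗ[ℝ] E) (B : E →ₗ[ℝ] E)
      rw [← this, hinv]
      exact LinearMap.det_id
    have h2 : |B'.det| * |B.det| = 1 := by rw [← abs_mul, h1, abs_one]
    nlinarith [abs_nonneg B.det, abs_nonneg B'.det]
  obtain ⟨m, hm, hlim⟩ := exists_pow_tendsto_one B hdet (hN.exists_pow_le hL)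
  have hlim' : Tendsto (fun k => B' ^ m k) atTop (𝓝 1) := by
    have h1 := (NormedRing.inverse_continuousAt (1 : (E →L[ℝ] E)ˣ)).tendsto.comp hlim
    rw [Ring.inverse_unit, inv_one, Units.val_one] at h1
    refine h1.congr fun k => ?_
    have hinv2 : B * B' = 1 := by
      rw [hB, hB', smul_mul_smul_comm, exp_neg_smul_mul_exp_smul, ← Real.exp_add]
      simp
    have hcomm : Commute B' B := hinv.trans hinv2.symm
    have h3 : B' ^ m k * B ^ m k = 1 := by rw [← hcomm.mul_pow, hinv, one_pow]
    have h4 : B ^ m k * B' ^ m k = 1 := by rw [← hcomm.symm.mul_pow, hinv2, one_pow]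
    change Ring.inverse (B ^ m k) = _
    rw [← one_mul (Ring.inverse _), ← h3, mul_assoc,
      Ring.mul_inverse_cancel _ ⟨⟨_, _, h4, h3⟩, rfl⟩, mul_one]
  -- With `l = exp (-m)`, flow homogeneity turns `N (l v) / l` into `N (B' ^ m v)`, and these powers
  -- tend to the identity along the recurrence times.
  refine ⟨fun k => Real.exp (-(m k)), fun k => Real.exp_pos _, ?_, fun v => ?_⟩
  · exact Real.tendsto_exp_atBot.comp
      (tendsto_neg_atTop_atBot.comp (tendsto_natCast_atTop_atTop.comp hm))
  · have h1 : Tendsto (fun k => N ((B' ^ m k) v)) atTop (𝓝 (N v)) := by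
      have := ((hN.continuous hL).comp (ContinuousLinearMap.apply ℝ E v).continuous).tendsto 1
      simpa [Function.comp_def] using this.comp hlim'
    refine h1.congr fun k => ?_
    rw [eq_div_iff (Real.exp_pos _).ne', mul_comm, ← hN.flow, hpow', smul_apply, map_smul,
      ← mul_apply_eq_comp, exp_neg_smul_mul_exp_smul, one_apply_eq_self]

/-- A flow-homogeneous function is positively homogeneous. -/
theorem map_smul_of_pos [FiniteDimensional ℝ E] (hL : HasUnitGrowth L)
    (hN : IsFlowHomogeneous L N) {t : ℝ} (ht : 0 < t) (v : E) : N (t • v) = t * N v := by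
  obtain ⟨l, hl, hl0, hlim⟩ := hN.exists_scales hL
  have key : ∀ s : ℝ, 0 < s → ∀ w, N (s • w) ≤ s * N w := by
    intro s hs w
    -- Cut `s` into an integer multiple of `l k`, handled by subadditivity, and a remainder below `l
    -- k`, on which `N` tends to `0`.
    have hfr : Tendsto (fun k => Int.fract (s / l k) * l k) atTop (𝓝 0) := by
      refine squeeze_zero (fun k => mul_nonneg (Int.fract_nonneg _) (hl k).le) (fun k => ?_) hl0
      exact mul_le_of_le_one_left (hl k).le (Int.fract_lt_one _).le
    have h1 : Tendsto (fun k => s * (N (l k • w) / l k) + N ((Int.fract (s / l k) * l k) • w))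
        atTop (𝓝 (s * N w + 0)) := by
      refine ((hlim w).const_mul s).add ((hN.tendsto_zero hL).comp ?_)
      simpa using hfr.smul_const w
    rw [add_zero] at h1
    refine ge_of_tendsto' h1 fun k => ?_
    have hn := Nat.floor_le (div_pos hs (hl k)).le
    have hsplit : s • w = ((⌊s / l k⌋₊ : ℕ) : ℝ) • (l k • w) +
        (Int.fract (s / l k) * l k) • w := by
      rw [smul_smul, ← add_smul, ← add_mul]
      congr 1
      have hfl : ((⌊s / l k⌋₊ : ℕ) : ℝ) = (⌊s / l k⌋ : ℝ) :=
        natCast_floor_eq_intCast_floor (div_pos hs (hl k)).le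
      rw [hfl, Int.floor_add_fract, div_mul_cancel₀ _ (hl k).ne']
    conv_lhs => rw [hsplit]
    refine (hN.add_le _ _).trans (add_le_add_left ((hN.nsmul_le _ _).trans ?_) _)
    rw [mul_div_assoc', mul_comm s, mul_div_assoc, mul_comm]
    exact mul_le_mul_of_nonneg_left hn (hN.nonneg _)
  -- The reverse inequality is the same one for the factor `t⁻¹` at the vector `t • v`.
  refine le_antisymm (key t ht v) ?_
  have := key t⁻¹ (inv_pos.2 ht) (t • v)
  rw [smul_smul, inv_mul_cancel₀ ht.ne', one_smul, le_inv_mul_iff₀ ht] at this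
  exact this

/-- A flow-homogeneous function as a seminorm. -/
def toSeminorm [FiniteDimensional ℝ E] (hL : HasUnitGrowth L) (hN : IsFlowHomogeneous L N) :
    Seminorm ℝ E :=
  Seminorm.of N hN.add_le fun a v => by
    rcases lt_trichotomy a 0 with h | rfl | h
    · rw [Real.norm_of_nonpos h.le, ← hN.neg, ← neg_smul, hN.map_smul_of_pos hL (neg_pos.2 h)]
    · simp [hN.map_zero]
    · rw [Real.norm_of_nonneg h.le, hN.map_smul_of_pos hL h]

end IsFlowHomogeneous

end HomogeneousNorm

/-! ### Integral curves of left-invariant fields and one-parameter subgroups -/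

noncomputable section OneParameterSubgroup

open Filter Topology

variable {E : Type*} [NormedAddCommGroup E] [NormedSpace ℝ E]
  {G : Type*} [TopologicalSpace G] [ChartedSpace E G] [Group G] [LieGroup 𝓘(ℝ, E) ∞ G]

lemma mdifferentiable_mul_left_smooth (g : G) :
    MDifferentiable 𝓘(ℝ, E) 𝓘(ℝ, E) (fun h : G => g * h) :=
  (contMDiff_mul_left (I := 𝓘(ℝ, E)) (n := ∞) (a := g)).mdifferentiable (by simp)

/-- The chain rule, with all tangent spaces identified with the model spaces. -/
lemma hasMFDerivAt_comp_of_eq {E₁ E₂ E₃ M₁ M₂ M₃ : Type*}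
    [NormedAddCommGroup E₁] [NormedSpace ℝ E₁] [TopologicalSpace M₁] [ChartedSpace E₁ M₁]
    [NormedAddCommGroup E₂] [NormedSpace ℝ E₂] [TopologicalSpace M₂] [ChartedSpace E₂ M₂]
    [NormedAddCommGroup E₃] [NormedSpace ℝ E₃] [TopologicalSpace M₃] [ChartedSpace E₃ M₃]
    {f : M₁ → M₂} {g : M₂ → M₃} {x : M₁} {y : M₂} (hy : f x = y)
    {g' : E₂ →L[ℝ] E₃} {f' : E₁ →L[ℝ] E₂}
    (hg : HasMFDerivAt 𝓘(ℝ, E₂) 𝓘(ℝ, E₃) g y g') (hf : HasMFDerivAt 𝓘(ℝ, E₁) 𝓘(ℝ, E₂) f x f') :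
    HasMFDerivAt 𝓘(ℝ, E₁) 𝓘(ℝ, E₃) (fun z => g (f z)) x (g' ∘L f' : E₁ →L[ℝ] E₃) := by
  subst hy
  exact HasMFDerivAt.comp x hg hf

/-- The differential of left translation by `g` at `h`, as an endomorphism of the model space. -/
def leftTranslationDeriv (E : Type*) [NormedAddCommGroup E] [NormedSpace ℝ E]
    {G : Type*} [TopologicalSpace G] [ChartedSpace E G] [Group G] (g h : G) : E →L[ℝ] E :=
  mfderiv 𝓘(ℝ, E) 𝓘(ℝ, E) (fun x : G => g * x) h

lemma hasMFDerivAt_mul_left_model (g h : G) :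
    HasMFDerivAt 𝓘(ℝ, E) 𝓘(ℝ, E) (fun x : G => g * x) h (leftTranslationDeriv E g h) :=
  (mdifferentiable_mul_left_smooth (E := E) g h).hasMFDerivAt

lemma leftTranslationDeriv_mul (g h : G) (v : E) :
    leftTranslationDeriv E g h (leftTranslationDeriv E h 1 v) =
      leftTranslationDeriv E (g * h) 1 v := by
  have h1 := hasMFDerivAt_comp_of_eq (mul_one h) (hasMFDerivAt_mul_left_model (E := E) g h)
    (hasMFDerivAt_mul_left_model (E := E) h 1)
  have h2 := hasMFDerivAt_mul_left_model (E := E) (g * h) 1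
  have h3 : (fun z => g * (h * z)) = fun z => g * h * z := by ext; simp [mul_assoc]
  rw [h3] at h1
  have h4 : leftTranslationDeriv E g h ∘L leftTranslationDeriv E h 1 =
      leftTranslationDeriv E (g * h) 1 := hasMFDerivAt_unique h1 h2
  exact DFunLike.congr_fun h4 v

omit [LieGroup 𝓘(ℝ, E) ∞ G] in
lemma isMIntegralCurve_mulInvariantVectorField_iff {γ : ℝ → G} {v : E} :
    IsMIntegralCurve (I := 𝓘(ℝ, E)) γ
      (mulInvariantVectorField (v : GroupLieAlgebra 𝓘(ℝ, E) G)) ↔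
    ∀ t, HasMFDerivAt 𝓘(ℝ, ℝ) 𝓘(ℝ, E) γ t
      ((1 : ℝ →L[ℝ] ℝ).smulRight (leftTranslationDeriv E (γ t) 1 v) : ℝ →L[ℝ] E) :=
  Iff.rfl

lemma IsMIntegralCurveAt.mul_left {γ : ℝ → G} {v : E} {t₀ : ℝ}
    (hγ : IsMIntegralCurveAt (I := 𝓘(ℝ, E)) γ (mulInvariantVectorField (v : GroupLieAlgebra 𝓘(ℝ, E) G)) t₀) (g : G) :
    IsMIntegralCurveAt (I := 𝓘(ℝ, E)) (fun t => g * γ t) (mulInvariantVectorField (v : GroupLieAlgebra 𝓘(ℝ, E) G)) t₀ := by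
  refine hγ.mono fun t ht => ?_
  have h1 := hasMFDerivAt_comp_of_eq (f := γ) rfl (hasMFDerivAt_mul_left_model (E := E) g (γ t))
    (f' := (1 : ℝ →L[ℝ] ℝ).smulRight (leftTranslationDeriv E (γ t) 1 v)) ht
  have h2 : leftTranslationDeriv E g (γ t) ∘L
      (1 : ℝ →L[ℝ] ℝ).smulRight (leftTranslationDeriv E (γ t) 1 v) =
      (1 : ℝ →L[ℝ] ℝ).smulRight (leftTranslationDeriv E (g * γ t) 1 v) := by
    ext
    simpa using leftTranslationDeriv_mul g (γ t) v
  rw [h2] at h1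
  exact h1

lemma IsMIntegralCurve.mul_left {γ : ℝ → G} {v : E}
    (hγ : IsMIntegralCurve (I := 𝓘(ℝ, E)) γ (mulInvariantVectorField (v : GroupLieAlgebra 𝓘(ℝ, E) G))) (g : G) :
    IsMIntegralCurve (I := 𝓘(ℝ, E)) (fun t => g * γ t) (mulInvariantVectorField (v : GroupLieAlgebra 𝓘(ℝ, E) G)) := by
  rw [isMIntegralCurve_iff_isMIntegralCurveAt] at *
  exact fun t => (hγ t).mul_left g

lemma contMDiff_one_mulInvariantVectorField (v : GroupLieAlgebra 𝓘(ℝ, E) G) :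
    ContMDiff 𝓘(ℝ, E) 𝓘(ℝ, E).tangent 1
      (fun g => (⟨g, mulInvariantVectorField v g⟩ : TangentBundle 𝓘(ℝ, E) G)) :=
  (contMDiff_mulInvariantVectorField v).of_le (le_trans (by norm_num) le_minSmoothness)

/-- A one-parameter subgroup of a Lie group with initial velocity `v`. -/
structure IsOneParameterSubgroup (γ : ℝ → G) (v : E) : Prop where
  map_add : ∀ s t, γ (s + t) = γ s * γ t
  hasMFDerivAt : HasMFDerivAt 𝓘(ℝ, ℝ) 𝓘(ℝ, E) γ 0 ((1 : ℝ →L[ℝ] ℝ).smulRight v : ℝ →L[ℝ] E)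

namespace IsOneParameterSubgroup

variable {γ γ' : ℝ → G} {v w : E}

omit [LieGroup 𝓘(ℝ, E) ∞ G] in
lemma map_zero (hγ : IsOneParameterSubgroup γ v) : γ 0 = 1 := by
  simpa using hγ.map_add 0 0

lemma isMIntegralCurve (hγ : IsOneParameterSubgroup γ v) :
    IsMIntegralCurve (I := 𝓘(ℝ, E)) γ
      (mulInvariantVectorField (v : GroupLieAlgebra 𝓘(ℝ, E) G)) := by
  refine isMIntegralCurve_mulInvariantVectorField_iff.2 fun t => ?_
  have h0 : HasMFDerivAt 𝓘(ℝ, ℝ) 𝓘(ℝ, ℝ) (fun u : ℝ => u - t) t (ContinuousLinearMap.id ℝ ℝ) :=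
    ((hasFDerivAt_id t).sub_const t).hasMFDerivAt
  have h1 := hasMFDerivAt_comp_of_eq (hγ.map_zero)
    (hasMFDerivAt_mul_left_model (E := E) (γ t) 1) hγ.hasMFDerivAt
  have h2 := hasMFDerivAt_comp_of_eq (f := fun u : ℝ => u - t) (sub_self t) h1 h0
  have h3 : (fun u => γ t * γ (u - t)) = γ := by
    ext u
    simp [← hγ.map_add]
  rw [h3] at h2
  have h4 : (leftTranslationDeriv E (γ t) 1 ∘L (1 : ℝ →L[ℝ] ℝ).smulRight v) ∘L
      ContinuousLinearMap.id ℝ ℝ =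
      (1 : ℝ →L[ℝ] ℝ).smulRight (leftTranslationDeriv E (γ t) 1 v) := by
    ext
    simp
  rw [h4] at h2
  exact h2

/-- Both `t ↦ γ (s + t)` and `t ↦ γ s * γ t` are integral curves starting at `γ s`, so they agree by
uniqueness. -/
lemma of_isMIntegralCurve [T2Space G] [CompleteSpace E]
    (h0 : γ 0 = 1) (hγ : IsMIntegralCurve (I := 𝓘(ℝ, E)) γ
      (mulInvariantVectorField (v : GroupLieAlgebra 𝓘(ℝ, E) G))) :
    IsOneParameterSubgroup γ v := by
  refine ⟨fun s t => ?_, ?_⟩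
  · have h1 := hγ.comp_add s
    have h2 := hγ.mul_left (γ s)
    have := isMIntegralCurve_Ioo_eq_of_contMDiff_boundaryless (t₀ := 0)
      (contMDiff_one_mulInvariantVectorField (v : GroupLieAlgebra 𝓘(ℝ, E) G)) h1 h2 (by simp [h0])
    simpa [add_comm] using congrFun this t
  · have h1 := isMIntegralCurve_mulInvariantVectorField_iff.1 hγ 0
    have h2 : leftTranslationDeriv E (γ 0) 1 v = v := by
      have h3 := hasMFDerivAt_mul_left_model (E := E) (1 : G) 1
      have h5 : (fun x : G => 1 * x) = id := by ext; simp
      rw [h5] at h3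
      have h4 : leftTranslationDeriv E (1 : G) 1 = ContinuousLinearMap.id ℝ E :=
        hasMFDerivAt_unique h3 (hasMFDerivAt_id 1)
      rw [h0, h4]
      rfl
    rw [h2] at h1
    exact h1

lemma unique [T2Space G] [CompleteSpace E] (hγ : IsOneParameterSubgroup γ v)
    (hγ' : IsOneParameterSubgroup γ' v) : γ = γ' :=
  isMIntegralCurve_Ioo_eq_of_contMDiff_boundaryless (t₀ := 0)
    (contMDiff_one_mulInvariantVectorField (v : GroupLieAlgebra 𝓘(ℝ, E) G))
    hγ.isMIntegralCurve hγ'.isMIntegralCurve (by rw [hγ.map_zero, hγ'.map_zero])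

end IsOneParameterSubgroup

/-- Left translates of one local integral curve exist for the same time `ε` at every point, and a
uniform existence time makes the field complete. -/
lemma exists_isOneParameterSubgroup [T2Space G] [CompleteSpace E] (v : E) :
    ∃ γ : ℝ → G, IsOneParameterSubgroup γ v := by
  have hv := contMDiff_one_mulInvariantVectorField (G := G) (E := E) v
  obtain ⟨γ, h0, hγ⟩ := exists_isMIntegralCurveAt_of_contMDiffAt_boundaryless (t₀ := 0)
    (hv.contMDiffAt (x := 1))
  obtain ⟨ε, hε, hγ⟩ := isMIntegralCurveAt_iff'.1 hγ
  rw [Real.ball_eq_Ioo, zero_sub, zero_add] at hγ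
  have hmul : ∀ g, IsMIntegralCurveOn (I := 𝓘(ℝ, E)) (fun t => g * γ t)
      (mulInvariantVectorField (v : GroupLieAlgebra 𝓘(ℝ, E) G)) (Set.Ioo (-ε) ε) := fun g =>
    (isMIntegralCurveOn_iff_isMIntegralCurveAt isOpen_Ioo).2 fun t ht =>
      ((isMIntegralCurveOn_iff_isMIntegralCurveAt isOpen_Ioo).1 hγ t ht).mul_left g
  obtain ⟨β, hβ0, hβ⟩ := exists_isMIntegralCurve_of_isMIntegralCurveOn hv hε
    (fun g => ⟨fun t => g * γ t, by simp [h0], hmul g⟩) 1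
  exact ⟨β, .of_isMIntegralCurve hβ0 hβ⟩

end OneParameterSubgroup

/-! ### The adjoint representation and its differential -/

noncomputable section AdjointRepresentation

open Filter Topology

/-- Under a flow with unit growth there are no nonzero equivariant bilinear maps: the flow would
have to scale their values by the square of its own rate. -/
lemma HasUnitGrowth.bilinear_eq_zero {E : Type*} [NormedAddCommGroup E] [NormedSpace ℝ E]
    [CompleteSpace E] {L : E →L[ℝ] E} (hL : HasUnitGrowth L) (b : E →L[ℝ] E →L[ℝ] E)
    (hb : ∀ (t : ℝ) (v w : E), NormedSpace.exp (t • L) (b v w) =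
      b (NormedSpace.exp (t • L) v) (NormedSpace.exp (t • L) w)) : b = 0 := by
  ext v w
  -- For `t ≤ 0` the outer factor grows at most like `exp (-t - t/6)` and each inner one like `exp
  -- (t - t/6)`; the product is `exp (t/2)`, which tends to `0` as `t → -∞`.
  obtain ⟨C, hC0, hC⟩ := hL (1 / 6) (by norm_num)
  have hbound : ∀ t : ℝ, t ≤ 0 → ‖b v w‖ ≤ C * ‖b‖ * C * C * ‖v‖ * ‖w‖ * Real.exp (t / 2) := by
    intro t ht
    have h1 : b v w = NormedSpace.exp ((-t) • L) (b (NormedSpace.exp (t • L) v)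
        (NormedSpace.exp (t • L) w)) := by
      rw [← hb, ← mul_apply_eq_comp, exp_neg_smul_mul_exp_smul, one_apply_eq_self]
    have h2 := hC t
    have h3 := hC (-t)
    rw [abs_neg] at h3
    rw [abs_of_nonpos ht] at h2 h3
    calc ‖b v w‖ ≤ ‖NormedSpace.exp ((-t) • L)‖ * (‖b‖ * (‖NormedSpace.exp (t • L)‖ * ‖v‖) *
          (‖NormedSpace.exp (t • L)‖ * ‖w‖)) := by
          conv_lhs => rw [h1]
          refine (ContinuousLinearMap.le_opNorm _ _).trans ?_
          gcongr
          refine (b.le_opNorm₂ _ _).trans ?_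
          gcongr <;> exact ContinuousLinearMap.le_opNorm _ _
      _ ≤ (C * Real.exp (-t + 1 / 6 * -t)) * (‖b‖ * ((C * Real.exp (t + 1 / 6 * -t)) * ‖v‖) *
          ((C * Real.exp (t + 1 / 6 * -t)) * ‖w‖)) := by gcongr
      _ = C * ‖b‖ * C * C * ‖v‖ * ‖w‖ * (Real.exp (-t + 1 / 6 * -t) *
          Real.exp (t + 1 / 6 * -t) * Real.exp (t + 1 / 6 * -t)) := by ring
      _ = _ := by
          rw [← Real.exp_add, ← Real.exp_add]
          ring_nf
  have h1 : Tendsto (fun t : ℝ => C * ‖b‖ * C * C * ‖v‖ * ‖w‖ * Real.exp (t / 2)) atBot (𝓝 0) := by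
    simpa using (Real.tendsto_exp_atBot.comp
      (tendsto_id.atBot_div_const (by norm_num : (0 : ℝ) < 2))).const_mul
        (C * ‖b‖ * C * C * ‖v‖ * ‖w‖)
  have h2 : ‖b v w‖ ≤ 0 := ge_of_tendsto h1 ((eventually_le_atBot 0).mono hbound)
  simpa using h2

variable {E : Type*} [NormedAddCommGroup E] [NormedSpace ℝ E]
  {G : Type*} [TopologicalSpace G] [ChartedSpace E G] [Group G]

/-- The adjoint representation of a Lie group, on the model space of the group. -/
def lieAd (E : Type*) [NormedAddCommGroup E] [NormedSpace ℝ E]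
    {G : Type*} [TopologicalSpace G] [ChartedSpace E G] [Group G] (g : G) : E →L[ℝ] E :=
  mfderiv 𝓘(ℝ, E) 𝓘(ℝ, E) (fun x : G => g * x * g⁻¹) 1

/-- The preferred chart at the identity has the identity as its differential there. -/
lemma hasMFDerivAt_extChartAt_one :
    HasMFDerivAt 𝓘(ℝ, E) 𝓘(ℝ, E) (extChartAt 𝓘(ℝ, E) (1 : G)) 1 (ContinuousLinearMap.id ℝ E) := by
  refine ⟨continuousAt_extChartAt _, ?_⟩
  have h : HasFDerivAt (id : E → E) (ContinuousLinearMap.id ℝ E)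
      (extChartAt 𝓘(ℝ, E) (1 : G) 1) := hasFDerivAt_id _
  refine HasFDerivAt.hasFDerivWithinAt (h.congr_of_eventuallyEq ?_)
  filter_upwards [extChartAt_target_mem_nhds (I := 𝓘(ℝ, E)) (1 : G)] with x hx
  simp only [writtenInExtChartAt, Function.comp, id]
  exact (extChartAt 𝓘(ℝ, E) (1 : G)).right_inv hx

lemma hasMFDerivAt_extChartAt_one_symm :
    HasMFDerivAt 𝓘(ℝ, E) 𝓘(ℝ, E) (extChartAt 𝓘(ℝ, E) (1 : G)).symm
      (extChartAt 𝓘(ℝ, E) (1 : G) 1) (ContinuousLinearMap.id ℝ E) := by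
  refine ⟨continuousAt_extChartAt_symm _, ?_⟩
  have h : HasFDerivAt (id : E → E) (ContinuousLinearMap.id ℝ E)
      (extChartAt 𝓘(ℝ, E) (1 : G) 1) := hasFDerivAt_id _
  refine HasFDerivAt.hasFDerivWithinAt (h.congr_of_eventuallyEq ?_)
  filter_upwards [extChartAt_target_mem_nhds (I := 𝓘(ℝ, E)) (1 : G)] with x hx
  simp only [writtenInExtChartAt, Function.comp, id, extChartAt_to_inv]
  exact (extChartAt 𝓘(ℝ, E) (1 : G)).right_inv hx

variable [LieGroup 𝓘(ℝ, E) ∞ G]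

lemma hasMFDerivAt_conj (g : G) :
    HasMFDerivAt 𝓘(ℝ, E) 𝓘(ℝ, E) (fun x : G => g * x * g⁻¹) 1 (lieAd E g) := by
  have h : ContMDiff 𝓘(ℝ, E) 𝓘(ℝ, E) ∞ (fun x : G => g * x * g⁻¹) :=
    (contMDiff_const.mul contMDiff_id).mul contMDiff_const
  exact (h.mdifferentiable (by simp) 1).hasMFDerivAt

lemma lieAd_eq_of_hasMFDerivAt {g : G} {D : E →L[ℝ] E}
    (h : HasMFDerivAt 𝓘(ℝ, E) 𝓘(ℝ, E) (fun x : G => g * x * g⁻¹) 1 D) : lieAd E g = D :=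
  hasMFDerivAt_unique (hasMFDerivAt_conj g) h

lemma lieAd_one : lieAd E (1 : G) = 1 := by
  refine lieAd_eq_of_hasMFDerivAt ?_
  have h5 : (fun x : G => 1 * x * 1⁻¹) = id := by ext; simp
  rw [h5]
  exact hasMFDerivAt_id _

lemma lieAd_mul (g h : G) : lieAd E (g * h) = lieAd E g * lieAd E h := by
  refine lieAd_eq_of_hasMFDerivAt ?_
  have h1 := hasMFDerivAt_comp_of_eq (f := fun x : G => h * x * h⁻¹) (by simp)
    (hasMFDerivAt_conj (E := E) g) (hasMFDerivAt_conj (E := E) h)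
  have h2 : (fun x : G => g * (h * x * h⁻¹) * g⁻¹) = fun x => g * h * x * (g * h)⁻¹ := by
    ext; simp [mul_assoc]
  rw [h2] at h1
  exact h1

lemma contMDiffAt_extChartAt_one_symm :
    ContMDiffAt 𝓘(ℝ, E) 𝓘(ℝ, E) ∞ (extChartAt 𝓘(ℝ, E) (1 : G)).symm
      (extChartAt 𝓘(ℝ, E) (1 : G) 1) :=
  (contMDiffOn_extChartAt_symm (1 : G)).contMDiffAt (extChartAt_target_mem_nhds _)

/-- In the chart at the identity `Ad` is the partial derivative, in the conjugated variable, of the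
smooth map `F`; it is therefore differentiable in the conjugating variable. -/
lemma exists_hasMFDerivAt_lieAd :
    ∃ a : E →L[ℝ] E →L[ℝ] E, HasMFDerivAt 𝓘(ℝ, E) 𝓘(ℝ, E →L[ℝ] E) (lieAd E : G → E →L[ℝ] E) 1 a := by
  set φ := extChartAt 𝓘(ℝ, E) (1 : G) with hφ
  let F : E → E → E := fun x y => φ (φ.symm x * φ.symm y * (φ.symm x)⁻¹)
  have hφ1 : φ.symm (φ 1) = 1 := extChartAt_to_inv _
  have hF : ContDiffAt ℝ ∞ (Function.uncurry F) (φ 1, φ 1) := by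
    rw [← contMDiffAt_iff_contDiffAt]
    have h1 : ContMDiffAt 𝓘(ℝ, E × E) 𝓘(ℝ, E) ∞ (fun p : E × E => φ.symm p.1) (φ 1, φ 1) :=
      ContMDiffAt.comp (x := (φ 1, φ 1)) (g := φ.symm) (f := Prod.fst)
        contMDiffAt_extChartAt_one_symm contDiff_fst.contMDiff.contMDiffAt
    have h2 : ContMDiffAt 𝓘(ℝ, E × E) 𝓘(ℝ, E) ∞ (fun p : E × E => φ.symm p.2) (φ 1, φ 1) :=
      ContMDiffAt.comp (x := (φ 1, φ 1)) (g := φ.symm) (f := Prod.snd)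
        contMDiffAt_extChartAt_one_symm contDiff_snd.contMDiff.contMDiffAt
    have h3 := (h1.mul h2).mul h1.inv
    refine ContMDiffAt.comp (x := (φ 1, φ 1)) (g := φ) ?_ h3
    have : φ.symm (φ 1) * φ.symm (φ 1) * (φ.symm (φ 1))⁻¹ = 1 := by simp [hφ1]
    simp only [this]
    exact contMDiffAt_extChartAt
  have hAd : ∀ᶠ x in 𝓝 (φ 1), lieAd E (φ.symm x) = fderiv ℝ (F x) (φ 1) := by
    filter_upwards with x
    have h1 := hasMFDerivAt_comp_of_eq (f := φ.symm) hφ1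
      (hasMFDerivAt_conj (E := E) (φ.symm x)) hasMFDerivAt_extChartAt_one_symm
    have h2 := hasMFDerivAt_comp_of_eq (f := fun y => φ.symm x * φ.symm y * (φ.symm x)⁻¹)
      (y := 1) (by simp [hφ1]) hasMFDerivAt_extChartAt_one h1
    have h3 : HasFDerivAt (F x) (ContinuousLinearMap.id ℝ E ∘L
        (lieAd E (φ.symm x) ∘L ContinuousLinearMap.id ℝ E)) (φ 1) := h2.hasFDerivAt
    exact h3.fderiv.symm
  have hsm : ContDiffAt ℝ 1 (fun x => fderiv ℝ (F x) (φ 1)) (φ 1) :=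
    ContDiffAt.fderiv (m := 1) (n := ∞) hF contDiffAt_const (WithTop.coe_le_coe.2 le_top)
  have hd := ((hsm.differentiableAt (by norm_num)).hasFDerivAt.congr_of_eventuallyEq hAd)
  refine ⟨fderiv ℝ (fun x => fderiv ℝ (F x) (φ 1)) (φ 1) ∘L ContinuousLinearMap.id ℝ E, ?_⟩
  have h1 := hasMFDerivAt_comp_of_eq (f := φ) rfl hd.hasMFDerivAt hasMFDerivAt_extChartAt_one
  refine h1.congr_of_eventuallyEq ?_
  filter_upwards [extChartAt_source_mem_nhds (I := 𝓘(ℝ, E)) (1 : G)] with g hg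
  rw [φ.left_inv hg]

end AdjointRepresentation

/-! ### Vanishing of the differential of `Ad` and commuting subgroups -/

noncomputable section CommutingSubgroups

open Filter Topology

variable {E : Type*} [NormedAddCommGroup E] [NormedSpace ℝ E]
  {G : Type*} [TopologicalSpace G] [ChartedSpace E G] [Group G] [LieGroup 𝓘(ℝ, E) ∞ G]

/-- Differentiate `f (g x g⁻¹) = f g f x (f g)⁻¹` at the identity. -/
lemma lieAd_map (f : G →* G) {D : E →L[ℝ] E} (hf : HasMFDerivAt 𝓘(ℝ, E) 𝓘(ℝ, E) f 1 D) (g : G) :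
    lieAd E (f g) ∘L D = D ∘L lieAd E g := by
  have h1 := hasMFDerivAt_comp_of_eq (f := f) (map_one f) (hasMFDerivAt_conj (E := E) (f g)) hf
  have h2 := hasMFDerivAt_comp_of_eq (f := fun x : G => g * x * g⁻¹) (by simp) hf
    (hasMFDerivAt_conj (E := E) g)
  have h3 : (fun x => f (g * x * g⁻¹)) = fun x => f g * f x * (f g)⁻¹ := by ext; simp
  rw [h3] at h2
  exact hasMFDerivAt_unique h1 h2

/-- If a Lie group has automorphisms with differentials `exp (t L)`, where this flow has unit
growth, then its adjoint representation has zero differential. -/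
lemma hasMFDerivAt_lieAd_zero [CompleteSpace E] {L : E →L[ℝ] E} (hL : HasUnitGrowth L)
    (D : ℝ → E →L[ℝ] E) (hD : ∀ t, D t = NormedSpace.exp (t • L)) (f : ℝ → G →* G)
    (hf : ∀ t, HasMFDerivAt 𝓘(ℝ, E) 𝓘(ℝ, E) (f t) 1 (D t)) :
    HasMFDerivAt 𝓘(ℝ, E) 𝓘(ℝ, E →L[ℝ] E) (lieAd E : G → E →L[ℝ] E) 1
      (0 : E →L[ℝ] E →L[ℝ] E) := by
  obtain ⟨a, ha⟩ := exists_hasMFDerivAt_lieAd (E := E) (G := G)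
  rw [← hL.bilinear_eq_zero a ?_]
  · exact ha
  intro t v w
  rw [← hD]
  -- Differentiating `Ad (f g) ∘ D = D ∘ Ad g` in `g` at the identity yields the equivariance of
  -- `a`.
  have h1 := hasMFDerivAt_comp_of_eq (f := f t) (map_one _) ha (hf t)
  have h2 := hasMFDerivAt_comp_of_eq (f := fun g => lieAd E (f t g)) rfl
    ((ContinuousLinearMap.compL ℝ E E E).flip (D t)).hasFDerivAt.hasMFDerivAt h1
  have h3 := hasMFDerivAt_comp_of_eq (f := (lieAd E : G → E →L[ℝ] E)) rfl
    (ContinuousLinearMap.compL ℝ E E E (D t)).hasFDerivAt.hasMFDerivAt ha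
  have h4 : (fun g => (ContinuousLinearMap.compL ℝ E E E).flip (D t) (lieAd E (f t g))) =
      fun g => ContinuousLinearMap.compL ℝ E E E (D t) (lieAd E g) := by
    ext1 g
    exact lieAd_map (f t) (hf t) g
  rw [h4] at h2
  have h5 : (ContinuousLinearMap.compL ℝ E E E).flip (D t) ∘L (a ∘L D t) =
      ContinuousLinearMap.compL ℝ E E E (D t) ∘L a := hasMFDerivAt_unique h2 h3
  exact (DFunLike.congr_fun (DFunLike.congr_fun h5 v) w).symm

namespace IsOneParameterSubgroup

variable {γ γ' : ℝ → G} {v w : E}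

lemma lieAd_eq_one (hγ : IsOneParameterSubgroup γ v)
    (ha : HasMFDerivAt 𝓘(ℝ, E) 𝓘(ℝ, E →L[ℝ] E) (lieAd E : G → E →L[ℝ] E) 1
      (0 : E →L[ℝ] E →L[ℝ] E)) (s : ℝ) : lieAd E (γ s) = 1 := by
  have h0 : HasDerivAt (fun s => lieAd E (γ s)) 0 0 := by
    have h1 := hasMFDerivAt_comp_of_eq hγ.map_zero ha hγ.hasMFDerivAt
    have h2 : HasFDerivAt (fun s => lieAd E (γ s)) ((0 : E →L[ℝ] E →L[ℝ] E) ∘L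
      ((1 : ℝ →L[ℝ] ℝ).smulRight v : ℝ →L[ℝ] E)) 0 := h1.hasFDerivAt
    simpa using h2.hasDerivAt
  -- `Ad ∘ γ` is multiplicative, so its derivative at `t` is `Ad (γ t)` times the zero derivative at
  -- `0`.
  have h1 : ∀ t, HasDerivAt (fun s => lieAd E (γ s)) 0 t := by
    intro t
    have h2 : HasDerivAt (fun s => lieAd E (γ (s - t))) 0 t :=
      HasDerivAt.comp_sub_const (f := fun s => lieAd E (γ s)) t t (by simpa using h0)
    have h3 := h2.const_mul (lieAd E (γ t))
    rw [mul_zero] at h3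
    refine h3.congr_of_eventuallyEq (Eventually.of_forall fun u => ?_)
    simp only [← lieAd_mul, ← hγ.map_add, add_sub_cancel]
  have h2 := is_const_of_deriv_eq_zero (fun t => (h1 t).differentiableAt) (fun t => (h1 t).deriv) s 0
  simp only [hγ.map_zero, lieAd_one] at h2
  exact h2

omit [LieGroup 𝓘(ℝ, E) ∞ G] in
lemma map_monoidHom (hγ : IsOneParameterSubgroup γ v) (f : G →* G) {D : E →L[ℝ] E}
    (hf : HasMFDerivAt 𝓘(ℝ, E) 𝓘(ℝ, E) f 1 D) :
    IsOneParameterSubgroup (fun t => f (γ t)) (D v) := by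
  refine ⟨fun s t => by rw [hγ.map_add, map_mul], ?_⟩
  have h1 := hasMFDerivAt_comp_of_eq hγ.map_zero hf hγ.hasMFDerivAt
  have h2 : D ∘L (1 : ℝ →L[ℝ] ℝ).smulRight v = (1 : ℝ →L[ℝ] ℝ).smulRight (D v) := by
    ext; simp
  rw [h2] at h1
  exact h1

/-- One-parameter subgroups commute if the adjoint representation has zero differential. -/
lemma commute [T2Space G] [CompleteSpace E]
    (ha : HasMFDerivAt 𝓘(ℝ, E) 𝓘(ℝ, E →L[ℝ] E) (lieAd E : G → E →L[ℝ] E) 1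
      (0 : E →L[ℝ] E →L[ℝ] E))
    (hγ : IsOneParameterSubgroup γ v) (hγ' : IsOneParameterSubgroup γ' w) (s t : ℝ) :
    γ s * γ' t = γ' t * γ s := by
  -- The conjugate of `γ'` by `γ s` has initial velocity `Ad (γ s) w = w`, hence is `γ'` itself.
  have h1 : IsOneParameterSubgroup (fun t => γ s * γ' t * (γ s)⁻¹) (lieAd E (γ s) w) :=
    hγ'.map_monoidHom (MulAut.conj (γ s)).toMonoidHom (hasMFDerivAt_conj (E := E) (γ s))
  rw [hγ.lieAd_eq_one ha, one_apply_eq_self] at h1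
  have := congrFun (h1.unique hγ') t
  exact mul_inv_eq_iff_eq_mul.1 this

omit [LieGroup 𝓘(ℝ, E) ∞ G] in
lemma comp_mul (hγ : IsOneParameterSubgroup γ v) (c : ℝ) :
    IsOneParameterSubgroup (fun t => γ (c * t)) (c • v) := by
  refine ⟨fun s t => by rw [mul_add, hγ.map_add], ?_⟩
  have h0 : HasMFDerivAt 𝓘(ℝ, ℝ) 𝓘(ℝ, ℝ) (fun t : ℝ => c * t) 0
      ((1 : ℝ →L[ℝ] ℝ).smulRight c : ℝ →L[ℝ] ℝ) := by
    have : HasFDerivAt (fun t : ℝ => c * t) ((1 : ℝ →L[ℝ] ℝ).smulRight c) 0 := by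
      refine ((hasDerivAt_id (0 : ℝ)).const_mul c).hasFDerivAt.congr_fderiv ?_
      ext
      simp
    exact this.hasMFDerivAt
  have h1 := hasMFDerivAt_comp_of_eq (mul_zero c) hγ.hasMFDerivAt h0
  have h2 : ((1 : ℝ →L[ℝ] ℝ).smulRight v : ℝ →L[ℝ] E) ∘L ((1 : ℝ →L[ℝ] ℝ).smulRight c) =
      (1 : ℝ →L[ℝ] ℝ).smulRight (c • v) := by
    ext; simp
  rw [h2] at h1
  exact h1

end IsOneParameterSubgroup

end CommutingSubgroups

/-! ### Products and smoothness of one-parameter subgroups -/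

noncomputable section AdditiveExponential

open Filter Topology

/-- Solutions of a smooth autonomous differential equation are smooth. -/
lemma contDiffAt_of_eventually_hasDerivAt {E : Type*} [NormedAddCommGroup E] [NormedSpace ℝ E]
    {c : ℝ → E} {X : E → E} {t₀ : ℝ} (hX : ContDiffAt ℝ ∞ X (c t₀))
    (hc : ∀ᶠ t in 𝓝 t₀, HasDerivAt c (X (c t)) t) : ContDiffAt ℝ ∞ c t₀ := by
  -- Bootstrap: if `c` is `n` times continuously differentiable, so is `X ∘ c`, which is the
  -- derivative of `c`.
  refine contDiffAt_infty.2 fun n => ?_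
  induction n with
  | zero =>
    refine contDiffAt_zero.2 ⟨{t | HasDerivAt c (X (c t)) t}, hc, fun t ht => ?_⟩
    exact (HasDerivAt.continuousAt ht).continuousWithinAt
  | succ n ih =>
    rw [Nat.cast_succ, contDiffAt_succ_iff_hasFDerivAt]
    refine ⟨fun t => (1 : ℝ →L[ℝ] ℝ).smulRight (X (c t)), ⟨_, hc, fun t ht => ?_⟩, ?_⟩
    · refine (HasDerivAt.hasFDerivAt ht).congr_fderiv ?_
      ext
      simp
    · exact contDiffAt_const.smulRight ((contDiffAt_infty.1 hX n).comp t₀ ih)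

variable {E : Type*} [NormedAddCommGroup E] [NormedSpace ℝ E]
  {G : Type*} [TopologicalSpace G] [ChartedSpace E G] [Group G]

/-- The multiplication of a Lie group in the preferred chart at the identity. -/
def mulInChart (E : Type*) [NormedAddCommGroup E] [NormedSpace ℝ E]
    (G : Type*) [TopologicalSpace G] [ChartedSpace E G] [Group G] (p : E × E) : E :=
  extChartAt 𝓘(ℝ, E) (1 : G) ((extChartAt 𝓘(ℝ, E) (1 : G)).symm p.1 *
    (extChartAt 𝓘(ℝ, E) (1 : G)).symm p.2)

variable [LieGroup 𝓘(ℝ, E) ∞ G]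

lemma contDiffAt_mulInChart :
    ContDiffAt ℝ ∞ (mulInChart E G)
      (extChartAt 𝓘(ℝ, E) (1 : G) 1, extChartAt 𝓘(ℝ, E) (1 : G) 1) := by
  set φ := extChartAt 𝓘(ℝ, E) (1 : G) with hφ
  have hφ1 : φ.symm (φ 1) = 1 := extChartAt_to_inv _
  rw [← contMDiffAt_iff_contDiffAt]
  have h1 : ContMDiffAt 𝓘(ℝ, E × E) 𝓘(ℝ, E) ∞ (fun p : E × E => φ.symm p.1) (φ 1, φ 1) :=
    ContMDiffAt.comp (x := (φ 1, φ 1)) (g := φ.symm) (f := Prod.fst)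
      contMDiffAt_extChartAt_one_symm contDiff_fst.contMDiff.contMDiffAt
  have h2 : ContMDiffAt 𝓘(ℝ, E × E) 𝓘(ℝ, E) ∞ (fun p : E × E => φ.symm p.2) (φ 1, φ 1) :=
    ContMDiffAt.comp (x := (φ 1, φ 1)) (g := φ.symm) (f := Prod.snd)
      contMDiffAt_extChartAt_one_symm contDiff_snd.contMDiff.contMDiffAt
  have h3 : ContMDiffAt 𝓘(ℝ, E × E) 𝓘(ℝ, E) ∞ (fun p : E × E => φ.symm p.1 * φ.symm p.2)
      (φ 1, φ 1) := h1.mul h2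
  have h4 : ContMDiffAt 𝓘(ℝ, E) 𝓘(ℝ, E) ∞ φ 1 := contMDiffAt_extChartAt
  exact ContMDiffAt.comp_of_eq h4 h3
    (show φ.symm (φ 1) * φ.symm (φ 1) = 1 by rw [hφ1, mul_one])

lemma hasFDerivAt_mulInChart :
    HasFDerivAt (mulInChart E G) (ContinuousLinearMap.fst ℝ E E + ContinuousLinearMap.snd ℝ E E)
      (extChartAt 𝓘(ℝ, E) (1 : G) 1, extChartAt 𝓘(ℝ, E) (1 : G) 1) := by
  have hd := ((contDiffAt_mulInChart (E := E) (G := G)).differentiableAt (by simp)).hasFDerivAt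
  set φ := extChartAt 𝓘(ℝ, E) (1 : G) with hφ
  have hφ1 : φ.symm (φ 1) = 1 := extChartAt_to_inv _
  refine hd.congr_fderiv ?_
  set D := fderiv ℝ (mulInChart E G) (φ 1, φ 1)
  have hev : ∀ᶠ x in 𝓝 (φ 1), φ (φ.symm x) = x := by
    filter_upwards [extChartAt_target_mem_nhds (I := 𝓘(ℝ, E)) (1 : G)] with x hx
    exact φ.right_inv hx
  have h1 : D ∘L ContinuousLinearMap.inl ℝ E E = ContinuousLinearMap.id ℝ E := by
    have h2 := HasFDerivAt.comp (φ 1) (f := fun x => (x, φ 1)) hd (hasFDerivAt_prodMk_left _ _)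
    refine h2.unique ((hasFDerivAt_id _).congr_of_eventuallyEq ?_)
    filter_upwards [hev] with x hx
    change φ (φ.symm x * φ.symm (φ 1)) = x
    rw [hφ1, mul_one, hx]
  have h2 : D ∘L ContinuousLinearMap.inr ℝ E E = ContinuousLinearMap.id ℝ E := by
    have h2 := HasFDerivAt.comp (φ 1) (f := fun x => (φ 1, x)) hd (hasFDerivAt_prodMk_right _ _)
    refine h2.unique ((hasFDerivAt_id _).congr_of_eventuallyEq ?_)
    filter_upwards [hev] with x hx
    change φ (φ.symm (φ 1) * φ.symm x) = x
    rw [hφ1, one_mul, hx]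
  refine ContinuousLinearMap.ext fun p => ?_
  have h3 := DFunLike.congr_fun h1 p.1
  have h4 := DFunLike.congr_fun h2 p.2
  have h5 : p = (p.1, 0) + (0, p.2) := by simp
  conv_lhs => rw [h5, map_add]
  exact congrArg₂ (· + ·) h3 h4

namespace IsOneParameterSubgroup

variable {γ γ' : ℝ → G} {v w : E}

omit [LieGroup 𝓘(ℝ, E) ∞ G] in
lemma hasDerivAt_extChartAt (hγ : IsOneParameterSubgroup γ v) :
    HasDerivAt (fun t => extChartAt 𝓘(ℝ, E) (1 : G) (γ t)) v 0 := by
  have h1 := hasMFDerivAt_comp_of_eq hγ.map_zero hasMFDerivAt_extChartAt_one hγ.hasMFDerivAt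
  have h2 : HasFDerivAt (fun t => extChartAt 𝓘(ℝ, E) (1 : G) (γ t)) (ContinuousLinearMap.id ℝ E ∘L
    ((1 : ℝ →L[ℝ] ℝ).smulRight v : ℝ →L[ℝ] E)) 0 := h1.hasFDerivAt
  simpa using h2.hasDerivAt

omit [LieGroup 𝓘(ℝ, E) ∞ G] in
lemma eventually_mem_source (hγ : IsOneParameterSubgroup γ v) :
    ∀ᶠ t in 𝓝 0, γ t ∈ (extChartAt 𝓘(ℝ, E) (1 : G)).source := by
  refine hγ.hasMFDerivAt.1 ?_
  rw [hγ.map_zero]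
  exact extChartAt_source_mem_nhds _

/-- Commutation makes the product a homomorphism; its velocity is `v + w` because multiplication has
differential `(x, y) ↦ x + y` at the identity. -/
lemma mul (hγ : IsOneParameterSubgroup γ v) (hγ' : IsOneParameterSubgroup γ' w)
    (hcomm : ∀ s t, γ s * γ' t = γ' t * γ s) :
    IsOneParameterSubgroup (fun t => γ t * γ' t) (v + w) := by
  refine ⟨fun s t => ?_, ?_⟩
  · rw [hγ.map_add, hγ'.map_add, mul_assoc, mul_assoc, ← mul_assoc (γ t), hcomm t s, mul_assoc]
  have hmem : ∀ᶠ t in 𝓝 0, γ t * γ' t ∈ (extChartAt 𝓘(ℝ, E) (1 : G)).source := by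
    have := topologicalGroup_of_lieGroup 𝓘(ℝ, E) ∞ (G := G)
    have hc : ContinuousAt (fun t => γ t * γ' t) 0 := hγ.hasMFDerivAt.1.mul hγ'.hasMFDerivAt.1
    refine hc ?_
    change _ ∈ 𝓝 (γ 0 * γ' 0)
    rw [hγ.map_zero, hγ'.map_zero, mul_one]
    exact extChartAt_source_mem_nhds _
  set φ := extChartAt 𝓘(ℝ, E) (1 : G) with hφ
  have h1 : HasDerivAt (fun t => mulInChart E G (φ (γ t), φ (γ' t))) (v + w) 0 := by
    have h2 : HasFDerivAt (mulInChart E G)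
        (ContinuousLinearMap.fst ℝ E E + ContinuousLinearMap.snd ℝ E E)
        (φ (γ 0), φ (γ' 0)) := by
      rw [hγ.map_zero, hγ'.map_zero]; exact hasFDerivAt_mulInChart
    exact h2.comp_hasDerivAt (0 : ℝ) (hγ.hasDerivAt_extChartAt.prodMk hγ'.hasDerivAt_extChartAt)
  have h3 : HasMFDerivAt 𝓘(ℝ, ℝ) 𝓘(ℝ, E) (fun t => mulInChart E G (φ (γ t), φ (γ' t))) 0
      ((1 : ℝ →L[ℝ] ℝ).smulRight (v + w) : ℝ →L[ℝ] E) := by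
    have : HasFDerivAt (fun t => mulInChart E G (φ (γ t), φ (γ' t)))
        ((1 : ℝ →L[ℝ] ℝ).smulRight (v + w) : ℝ →L[ℝ] E) 0 := by
      refine h1.hasFDerivAt.congr_fderiv ?_
      ext
      simp
    exact this.hasMFDerivAt
  have h4 := hasMFDerivAt_comp_of_eq
    (f := fun t => mulInChart E G (φ (γ t), φ (γ' t))) (y := φ 1)
    (by simp [mulInChart, hγ.map_zero, hγ'.map_zero, hφ]) hasMFDerivAt_extChartAt_one_symm h3
  rw [ContinuousLinearMap.id_comp] at h4
  refine h4.congr_of_eventuallyEq ?_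
  filter_upwards [hmem, hγ.eventually_mem_source, hγ'.eventually_mem_source] with t h1 h2 h3
  simp only [mulInChart, ← hφ]
  rw [φ.left_inv h2, φ.left_inv h3, φ.left_inv h1]

lemma contMDiff (hγ : IsOneParameterSubgroup γ v) : ContMDiff 𝓘(ℝ, ℝ) 𝓘(ℝ, E) ∞ γ := by
  have h0 : ContMDiffAt 𝓘(ℝ, ℝ) 𝓘(ℝ, E) ∞ γ 0 := by
    set φ := extChartAt 𝓘(ℝ, E) (1 : G) with hφ
    have hφ1 : φ.symm (φ 1) = 1 := extChartAt_to_inv _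
    have hF := contDiffAt_mulInChart (E := E) (G := G)
    -- The left-invariant field of `v` read in the chart, as the derivative of multiplication in its
    -- second argument. The curve solves its equation near `0`, and translation carries smoothness
    -- to all times.
    let X : E → E := fun x => fderiv ℝ (mulInChart E G) (x, φ 1) (0, v)
    have hX : ContDiffAt ℝ ∞ X (φ 1) := by
      have h1 : ContDiffAt ℝ ∞ (fun x : E => fderiv ℝ (mulInChart E G) (x, φ 1)) (φ 1) :=
        ContDiffAt.comp (φ 1) (f := fun x : E => (x, φ 1)) (hF.fderiv_right (by simp))
          (contDiffAt_id.prodMk contDiffAt_const)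
      exact h1.clm_apply contDiffAt_const
    have hcont : Tendsto (fun t => φ (γ t)) (𝓝 0) (𝓝 (φ 1)) := by
      have := hγ.hasDerivAt_extChartAt.continuousAt.tendsto
      rwa [hγ.map_zero] at this
    have hdiff : ∀ᶠ t in 𝓝 (0 : ℝ), DifferentiableAt ℝ (mulInChart E G) (φ (γ t), φ 1) := by
      have h1 : ∀ᶠ p in 𝓝 (φ 1, φ 1), DifferentiableAt ℝ (mulInChart E G) p := by
        filter_upwards [(hF.of_le (show (1 : WithTop ℕ∞) ≤ ∞ from ENat.LEInfty.out)).eventually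
          (by simp)] with p hp
        exact hp.differentiableAt (by simp)
      have h2 : Tendsto (fun t => (φ (γ t), φ 1)) (𝓝 0) (𝓝 (φ 1, φ 1)) :=
        hcont.prodMk_nhds tendsto_const_nhds
      exact h2 h1
    have hc : ∀ᶠ t in 𝓝 (0 : ℝ), HasDerivAt (fun t => φ (γ t)) (X (φ (γ t))) t := by
      filter_upwards [hdiff, hγ.eventually_mem_source] with t ht hts
      have h1 : HasDerivAt (fun s => mulInChart E G (φ (γ t), φ (γ s))) (X (φ (γ t))) 0 := by
        have h2 : HasFDerivAt (mulInChart E G) (fderiv ℝ (mulInChart E G) (φ (γ t), φ 1))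
            (φ (γ t), φ (γ 0)) := by
          rw [hγ.map_zero]; exact ht.hasFDerivAt
        exact h2.comp_hasDerivAt (0 : ℝ)
          ((hasDerivAt_const (0 : ℝ) (φ (γ t))).prodMk hγ.hasDerivAt_extChartAt)
      have h2 : HasDerivAt (fun s => φ (γ (t + s))) (X (φ (γ t))) 0 := by
        refine h1.congr_of_eventuallyEq ?_
        filter_upwards [hγ.eventually_mem_source] with s hs
        simp only [mulInChart, ← hφ]
        rw [φ.left_inv hts, φ.left_inv hs, hγ.map_add]
      have h3 := HasDerivAt.comp_sub_const (f := fun s => φ (γ (t + s))) t t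
        (by rw [sub_self]; exact h2)
      simpa using h3
    have h1 : ContDiffAt ℝ ∞ (fun t => φ (γ t)) 0 :=
      contDiffAt_of_eventually_hasDerivAt (X := X) (by rw [hγ.map_zero]; exact hX) hc
    have h2 : ContMDiffAt 𝓘(ℝ, ℝ) 𝓘(ℝ, E) ∞ (fun t => φ.symm (φ (γ t))) 0 := by
      refine ContMDiffAt.comp (x := (0 : ℝ)) (g := φ.symm) (f := fun t => φ (γ t)) ?_ h1.contMDiffAt
      rw [hγ.map_zero]
      exact contMDiffAt_extChartAt_one_symm
    refine h2.congr_of_eventuallyEq ?_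
    filter_upwards [hγ.eventually_mem_source] with t ht
    rw [φ.left_inv ht]
  intro t
  have h1 : ContMDiffAt 𝓘(ℝ, ℝ) 𝓘(ℝ, E) ∞ (fun s => γ (s - t)) t := by
    refine ContMDiffAt.comp (x := t) (g := γ) (f := fun s => s - t) (by rwa [sub_self]) ?_
    exact (contDiff_id.sub contDiff_const).contMDiff.contMDiffAt
  have h2 := (contMDiffAt_const (c := γ t)).mul h1
  refine h2.congr_of_eventuallyEq (Eventually.of_forall fun s => ?_)
  simp [← hγ.map_add]

end IsOneParameterSubgroup

end AdditiveExponential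

/-! ### The exponential map as a homomorphism from the vector group -/

noncomputable section VectorExponential

open Filter Topology

variable {E : Type*} [NormedAddCommGroup E] [NormedSpace ℝ E]
  {G : Type*} [TopologicalSpace G] [ChartedSpace E G] [Group G]

/-- `Φ` is a smooth homomorphism from the vector group `E` to the Lie group `G` whose restrictions
to lines are the one-parameter subgroups of `G`. -/
structure IsVectorGroupExp (Φ : E → G) : Prop where
  map_add : ∀ v w, Φ (v + w) = Φ v * Φ w
  isOneParameterSubgroup : ∀ v, IsOneParameterSubgroup (fun t : ℝ => Φ (t • v)) v
  contMDiff : ContMDiff 𝓘(ℝ, E) 𝓘(ℝ, E) ∞ Φ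

/-- If the adjoint representation has zero differential, the exponential map of the group is a
smooth homomorphism. -/
lemma exists_isVectorGroupExp [FiniteDimensional ℝ E] [CompleteSpace E] [T2Space G]
    [LieGroup 𝓘(ℝ, E) ∞ G]
    (ha : HasMFDerivAt 𝓘(ℝ, E) 𝓘(ℝ, E →L[ℝ] E) (lieAd E : G → E →L[ℝ] E) 1
      (0 : E →L[ℝ] E →L[ℝ] E)) :
    ∃ Φ : E → G, IsVectorGroupExp Φ := by
  choose γ hγ using fun v : E => exists_isOneParameterSubgroup (G := G) v
  have hsmul : ∀ (t : ℝ) (v : E), γ (t • v) 1 = γ v t := fun t v => by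
    have := congrFun ((hγ (t • v)).unique ((hγ v).comp_mul t)) 1
    simpa using this
  have hadd : ∀ v w, γ (v + w) 1 = γ v 1 * γ w 1 := fun v w =>
    congrFun ((hγ (v + w)).unique ((hγ v).mul (hγ w) ((hγ v).commute ha (hγ w)))) 1
  refine ⟨fun v => γ v 1, hadd, fun v => ?_, ?_⟩
  · simp only [hsmul]
    exact hγ v
  · let b := Module.finBasis ℝ E
    -- Expanding in a basis writes the map as a finite product of smooth one-parameter subgroups
    -- evaluated at smooth coordinates.
    have hs : ∀ s : Finset (Fin (Module.finrank ℝ E)),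
        ContMDiff 𝓘(ℝ, E) 𝓘(ℝ, E) ∞ (fun v => γ (∑ i ∈ s, b.repr v i • b i) 1) := by
      intro s
      induction s using Finset.induction_on with
      | empty =>
        simp only [Finset.sum_empty]
        exact contMDiff_const
      | insert i s his ih =>
        simp only [Finset.sum_insert his, hadd, hsmul]
        have h1 : ContMDiff 𝓘(ℝ, E) 𝓘(ℝ, ℝ) ∞ (fun v => b.repr v i) :=
          (LinearMap.toContinuousLinearMap (b.coord i)).contDiff.contMDiff
        exact ((hγ (b i)).contMDiff.comp h1).mul ih
    have := hs Finset.univ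
    simp only [b.sum_repr] at this
    exact this

namespace IsVectorGroupExp

variable {Φ : E → G}

lemma map_zero (hΦ : IsVectorGroupExp Φ) : Φ 0 = 1 := by
  simpa using hΦ.map_add 0 0

lemma map_neg (hΦ : IsVectorGroupExp Φ) (v : E) : Φ (-v) = (Φ v)⁻¹ := by
  rw [eq_inv_iff_mul_eq_one, ← hΦ.map_add, neg_add_cancel, hΦ.map_zero]

lemma map_sub (hΦ : IsVectorGroupExp Φ) (v w : E) : Φ (v - w) = Φ v * (Φ w)⁻¹ := by
  rw [sub_eq_add_neg, hΦ.map_add, hΦ.map_neg]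

/-- The image of a vector group, as a subgroup. -/
def range (hΦ : IsVectorGroupExp Φ) : Subgroup G where
  carrier := Set.range Φ
  mul_mem' := by
    rintro _ _ ⟨v, rfl⟩ ⟨w, rfl⟩
    exact ⟨v + w, hΦ.map_add v w⟩
  one_mem' := ⟨0, hΦ.map_zero⟩
  inv_mem' := by
    rintro _ ⟨v, rfl⟩
    exact ⟨-v, hΦ.map_neg v⟩

lemma contDiffAt_extChartAt_comp [IsManifold 𝓘(ℝ, E) ∞ G] (hΦ : IsVectorGroupExp Φ) :
    ContDiffAt ℝ ∞ (fun v => extChartAt 𝓘(ℝ, E) (1 : G) (Φ v)) 0 := by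
  have h1 : ContMDiffAt 𝓘(ℝ, E) 𝓘(ℝ, E) ∞ (extChartAt 𝓘(ℝ, E) (1 : G)) 1 := contMDiffAt_extChartAt
  exact (ContMDiffAt.comp_of_eq h1 (hΦ.contMDiff.contMDiffAt (x := 0)) hΦ.map_zero).contDiffAt

/-- Along each ray the derivative is the velocity of a one-parameter subgroup. That the differential
is the identity opens the way to the inverse function theorem. -/
lemma hasFDerivAt_extChartAt_comp [IsManifold 𝓘(ℝ, E) ∞ G] (hΦ : IsVectorGroupExp Φ) :
    HasFDerivAt (fun v => extChartAt 𝓘(ℝ, E) (1 : G) (Φ v))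
      ((ContinuousLinearEquiv.refl ℝ E : E ≃L[ℝ] E) : E →L[ℝ] E) 0 := by
  have hd := (hΦ.contDiffAt_extChartAt_comp.differentiableAt (by simp)).hasFDerivAt
  refine hd.congr_fderiv (ContinuousLinearMap.ext fun v => ?_)
  have h1 := (hΦ.isOneParameterSubgroup v).hasDerivAt_extChartAt
  have h2 : HasDerivAt (fun t : ℝ => t • v) v 0 := by
    simpa using (hasDerivAt_id (0 : ℝ)).smul_const v
  have h3 : HasFDerivAt (fun v => extChartAt 𝓘(ℝ, E) (1 : G) (Φ v))
      (fderiv ℝ (fun v => extChartAt 𝓘(ℝ, E) (1 : G) (Φ v)) 0) ((0 : ℝ) • v) := by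
    rw [zero_smul]; exact hd
  have h4 := h3.comp_hasDerivAt (0 : ℝ) h2
  exact h4.unique h1

variable [CompleteSpace E]

lemma eventually_eq_zero [IsManifold 𝓘(ℝ, E) ∞ G] (hΦ : IsVectorGroupExp Φ) :
    ∀ᶠ v in 𝓝 (0 : E), Φ v = 1 → v = 0 := by
  have hs := hΦ.contDiffAt_extChartAt_comp.hasStrictFDerivAt' hΦ.hasFDerivAt_extChartAt_comp
    (by simp)
  filter_upwards [hs.eventually_left_inverse] with v hv h1
  have h0 := hs.localInverse_apply_image
  rw [h1] at hv
  rw [hΦ.map_zero, hv] at h0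
  exact h0

lemma exists_local_inverse [IsManifold 𝓘(ℝ, E) ∞ G] (hΦ : IsVectorGroupExp Φ) :
    ∃ g : G → E, ContMDiffAt 𝓘(ℝ, E) 𝓘(ℝ, E) ∞ g 1 ∧ ∀ᶠ p in 𝓝 (1 : G), Φ (g p) = p := by
  have hc := hΦ.contDiffAt_extChartAt_comp
  have hf := hΦ.hasFDerivAt_extChartAt_comp
  have hs := hc.hasStrictFDerivAt' hf (by simp)
  have hsm := hc.to_localInverse hf (by simp)
  have hright := hs.eventually_right_inverse
  have htend := hs.localInverse_tendsto
  rw [hΦ.map_zero] at hsm hright htend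
  set φ := extChartAt 𝓘(ℝ, E) (1 : G) with hφ
  have hφc : Tendsto φ (𝓝 1) (𝓝 (φ 1)) := continuousAt_extChartAt _
  refine ⟨fun p => hc.localInverse hf (by simp) (φ p), ?_, ?_⟩
  · have h1 : ContMDiffAt 𝓘(ℝ, E) 𝓘(ℝ, E) ∞ φ 1 := contMDiffAt_extChartAt
    exact ContMDiffAt.comp (1 : G) hsm.contMDiffAt h1
  · have hsrc : ∀ᶠ v in 𝓝 (0 : E), Φ v ∈ φ.source := by
      refine hΦ.contMDiff.continuous.continuousAt ?_
      rw [hΦ.map_zero]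
      exact extChartAt_source_mem_nhds _
    filter_upwards [hφc hright, hφc (htend hsrc), extChartAt_source_mem_nhds (I := 𝓘(ℝ, E)) (1 : G)]
      with p h1 h2 h3
    exact φ.injOn h2 h3 h1

variable [LieGroup 𝓘(ℝ, E) ∞ G]

lemma isOpen_range (hΦ : IsVectorGroupExp Φ) : IsOpen (hΦ.range : Set G) := by
  have := topologicalGroup_of_lieGroup 𝓘(ℝ, E) ∞ (G := G)
  obtain ⟨g, -, hg⟩ := hΦ.exists_local_inverse
  exact hΦ.range.isOpen_of_mem_nhds (g := 1) (hg.mono fun p hp => ⟨g p, hp⟩)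

/-- Near the identity `Ψ` coincides with the smooth local inverse; additivity of `Ψ` moves this to
any point by translation. -/
lemma contMDiff_of_inverse (hΦ : IsVectorGroupExp Φ) {Ψ : G → E} (hl : ∀ v, Ψ (Φ v) = v)
    (hr : ∀ p, Φ (Ψ p) = p) : ContMDiff 𝓘(ℝ, E) 𝓘(ℝ, E) ∞ Ψ := by
  obtain ⟨g, hg, hg'⟩ := hΦ.exists_local_inverse
  have h1 : ContMDiffAt 𝓘(ℝ, E) 𝓘(ℝ, E) ∞ Ψ 1 := by
    refine hg.congr_of_eventuallyEq ?_
    filter_upwards [hg'] with p hp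
    rw [← hl (g p), hp]
  intro p
  have h2 : ContMDiffAt 𝓘(ℝ, E) 𝓘(ℝ, E) ∞ (fun q => Ψ (p⁻¹ * q)) p :=
    ContMDiffAt.comp_of_eq h1 (contMDiff_mul_left (a := p⁻¹)).contMDiffAt (inv_mul_cancel p)
  have h3 : ContMDiffAt 𝓘(ℝ, E) 𝓘(ℝ, E) ∞ (fun v => Ψ p + v) (Ψ (p⁻¹ * p)) :=
    (contDiff_const.add contDiff_id).contMDiff.contMDiffAt
  refine (ContMDiffAt.comp p h3 h2).congr_of_eventuallyEq (Eventually.of_forall fun q => ?_)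
  change Ψ q = Ψ p + Ψ (p⁻¹ * q)
  rw [← hl (Ψ p + Ψ (p⁻¹ * q)), hΦ.map_add, hr, hr, mul_inv_cancel_left]

end IsVectorGroupExp

end VectorExponential

/-! ### Dilations make the exponential map bijective -/

noncomputable section

section DilationGroup

open Filter Topology

variable {E : Type*} [NormedAddCommGroup E] [NormedSpace ℝ E]

lemma HasUnitGrowth.tendsto_apply_zero {L : E →L[ℝ] E} (hL : HasUnitGrowth L) (v : E) :
    Tendsto (fun t : ℝ => NormedSpace.exp (t • L) v) atBot (𝓝 0) := by
  simpa [Function.comp_def] using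
    ((ContinuousLinearMap.apply ℝ E v).continuous.tendsto 0).comp hL.tendsto_zero

/-- A fixed vector of `S` is fixed by all its powers, which contract to `0`; so `1 - S` is
injective, hence onto in finite dimension. -/
lemma HasUnitGrowth.exists_sub_exp_eq [FiniteDimensional ℝ E] [CompleteSpace E] {L : E →L[ℝ] E} (hL : HasUnitGrowth L) (v : E) :
    ∃ w, w - NormedSpace.exp ((-1 : ℝ) • L) w = v := by
  set S := NormedSpace.exp ((-1 : ℝ) • L) with hS
  have hinj : Function.Injective ((1 - S : E →L[ℝ] E) : E →ₗ[ℝ] E) := by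
    refine (injective_iff_map_eq_zero _).2 fun w hw => ?_
    have hw' : S w = w := (sub_eq_zero.1 (show w - S w = 0 from hw)).symm
    have hpow : ∀ n : ℕ, NormedSpace.exp (((n : ℝ) * (-1)) • L) w = w := by
      intro n
      rw [exp_natCast_mul_smul, ← hS]
      induction n with
      | zero => simp
      | succ n ih => rw [pow_succ, mul_apply_eq_comp, hw', ih]
    have htend : Tendsto (fun n : ℕ => (n : ℝ) * (-1)) atTop atBot := by
      simpa [Function.comp_def] using
        tendsto_neg_atTop_atBot.comp (tendsto_natCast_atTop_atTop (R := ℝ))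
    have h2 := (hL.tendsto_apply_zero w).comp htend
    simp only [Function.comp_def, hpow] at h2
    exact tendsto_nhds_unique tendsto_const_nhds h2
  exact LinearMap.injective_iff_surjective.1 hinj v

variable [CompleteSpace E] {G : Type*} [TopologicalSpace G] [T2Space G] [ChartedSpace E G] [Group G]
  [LieGroup 𝓘(ℝ, E) ∞ G]

/-- A continuous one-parameter group `f` of automorphisms of a Lie group, written additively, with
differentials `exp (t L)`. -/
structure IsDilationFlow (L : E →L[ℝ] E) (D : ℝ → E →L[ℝ] E) (f : ℝ → G →* G) : Prop where
  hasUnitGrowth : HasUnitGrowth L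
  eq_exp : ∀ t, D t = NormedSpace.exp (t • L)
  hasMFDerivAt : ∀ t, HasMFDerivAt 𝓘(ℝ, E) 𝓘(ℝ, E) (f t) 1 (D t)
  map_zero : ∀ p, f 0 p = p
  continuous_orbit : ∀ p, Continuous fun t => f t p

namespace IsDilationFlow

variable {L : E →L[ℝ] E} {D : ℝ → E →L[ℝ] E} {f : ℝ → G →* G} {Φ : E → G}

/-- Both sides are values at time one of one-parameter subgroups with the same initial velocity. -/
lemma map_exp (hf : IsDilationFlow L D f) (hΦ : IsVectorGroupExp Φ) (t : ℝ) (v : E) :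
    f t (Φ v) = Φ (NormedSpace.exp (t • L) v) := by
  have h1 := (hΦ.isOneParameterSubgroup v).map_monoidHom (f t) (hf.hasMFDerivAt t)
  have h2 := congrFun (h1.unique (hΦ.isOneParameterSubgroup (D t v))) 1
  simpa [hf.eq_exp] using h2

lemma exists_isVectorGroupExp [FiniteDimensional ℝ E] (hf : IsDilationFlow L D f) :
    ∃ Φ : E → G, IsVectorGroupExp Φ :=
  _root_.exists_isVectorGroupExp
    (hasMFDerivAt_lieAd_zero hf.hasUnitGrowth D hf.eq_exp f hf.hasMFDerivAt)

/-- A discrete kernel of the exponential map which is invariant under a contracting flow is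
trivial. -/
lemma injective (hf : IsDilationFlow L D f) (hΦ : IsVectorGroupExp Φ) : Function.Injective Φ := by
  have hker : ∀ v, Φ v = 1 → v = 0 := by
    intro v hv
    obtain ⟨t, ht⟩ := ((hf.hasUnitGrowth.tendsto_apply_zero v).eventually
      hΦ.eventually_eq_zero).exists
    have h1 := ht (by rw [← hf.map_exp hΦ, hv, map_one])
    have h2 : NormedSpace.exp ((-t) • L) (NormedSpace.exp (t • L) v) = 0 := by
      rw [h1, _root_.map_zero]
    rwa [← mul_apply_eq_comp, exp_neg_smul_mul_exp_smul, one_apply_eq_self] at h2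
  intro v w hvw
  refine sub_eq_zero.1 (hker _ ?_)
  rw [hΦ.map_sub, hvw, mul_inv_cancel]

/-- If moreover the identity is the only fixed point of the contraction `f (-1)`, then the
exponential map is onto: every coset of its image is preserved and contains a fixed point. -/
lemma surjective [FiniteDimensional ℝ E] (hf : IsDilationFlow L D f) (hΦ : IsVectorGroupExp Φ)
    (hfix : ∀ q, f (-1) q = q → q = 1) : Function.Surjective Φ := by
  have := topologicalGroup_of_lieGroup 𝓘(ℝ, E) ∞ (G := G)
  intro p
  have hclopen : IsClopen (hΦ.range : Set G) :=
    ⟨hΦ.range.isClosed_of_isOpen hΦ.isOpen_range, hΦ.isOpen_range⟩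
  have hpath : Continuous fun t => p⁻¹ * f t p := continuous_const.mul (hf.continuous_orbit p)
  -- The time line is connected and the path starts at the identity, so it never leaves the clopen
  -- image of `Φ`.
  have huniv := (hclopen.preimage hpath).eq_univ ⟨0, by
    change p⁻¹ * f 0 p ∈ hΦ.range
    rw [hf.map_zero, inv_mul_cancel]
    exact hΦ.range.one_mem⟩
  obtain ⟨v, hv⟩ : p⁻¹ * f (-1) p ∈ hΦ.range := by
    have : (-1 : ℝ) ∈ (fun t => p⁻¹ * f t p) ⁻¹' (hΦ.range : Set G) := by rw [huniv]; trivial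
    exact this
  obtain ⟨w, rfl⟩ := hf.hasUnitGrowth.exists_sub_exp_eq v
  refine ⟨-w, ?_⟩
  -- With `f (-1) p = p Φ (w - S w)`, applying `f (-1)` to `p Φ w` gives `p Φ (w - S w) Φ (S w) = p
  -- Φ w`.
  have h1 := hfix (p * Φ w) (by
    rw [map_mul, hf.map_exp hΦ, ← mul_inv_cancel_left p (f (-1) p), ← hv, mul_assoc,
      ← hΦ.map_add, sub_add_cancel])
  rw [hΦ.map_neg, inv_eq_iff_mul_eq_one, mul_eq_one_iff_eq_inv, ← mul_eq_one_iff_inv_eq.1 h1]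

end IsDilationFlow

end DilationGroup

end

/-! ### The homogeneous distance is a vector norm -/

theorem proposition7p4 {E : Type*} [NormedAddCommGroup E] [NormedSpace ℝ E]
    [FiniteDimensional ℝ E] [CompleteSpace E]
    {G : Type*} [TopologicalSpace G] [T2Space G] [ChartedSpace E G] [Group G]
    [LieGroup 𝓘(ℝ, E) ∞ G]
    (A : LieDerivation ℝ (GroupLieAlgebra 𝓘(ℝ, E) G) (GroupLieAlgebra 𝓘(ℝ, E) G))
    (hA : realLayer A.toLinearMap 1 = ⊤)
    (d : G → G → ℝ) (hd : IsHomogeneousDist A.toLinearMap d) :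
    (∀ x y : G, x * y = y * x) ∧
    ∃ Φ : Diffeomorph 𝓘(ℝ, E) 𝓘(ℝ, E) E G ∞,
      IsLieExp (Φ : E → G) ∧
      (∀ v w : E, Φ (v + w) = Φ v * Φ w) ∧
      (∀ l : ℝ, 0 < l → ∀ v : E, d 1 (Φ (l • v)) = l * d 1 (Φ v)) ∧
      ∃ N : Seminorm ℝ E, (∀ v, N v = 0 → v = 0) ∧ ∀ v w : E, d (Φ v) (Φ w) = N (v - w) := by
  obtain ⟨hdist, δ, hδ, hhom⟩ := hd
  let A' : E →ₗ[ℝ] E := A.toLinearMap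
  have hL : HasUnitGrowth (LinearMap.toContinuousLinearMap A') := hasUnitGrowth_of_realLayer A' hA
  let e : ℝ → {l : ℝ // 0 < l} := fun t => ⟨Real.exp t, Real.exp_pos t⟩
  let D : ℝ → E →L[ℝ] E := fun t => mfderiv 𝓘(ℝ, E) 𝓘(ℝ, E) (δ (e t) : G → G) 1
  let f : ℝ → G →* G := fun t => (δ (e t)).toMonoidHom
  have hf : IsDilationFlow (LinearMap.toContinuousLinearMap A') D f := by
    refine ⟨hL, fun t => ?_, fun t => ?_, fun p => ?_, fun p => ?_⟩
    · refine ContinuousLinearMap.ext fun v => (hδ.differential (e t) v).trans ?_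
      simp only [rpowEnd, e, Real.log_exp]
      rfl
    · exact ((hδ.smooth (e t)).mdifferentiable (by simp) 1).hasMFDerivAt
    · have : e 0 = 1 := Subtype.ext Real.exp_zero
      simp [f, this]
    · exact (hδ.continuous_orbit p).comp (Real.continuous_exp.subtype_mk _)
  obtain ⟨Φ, hΦ⟩ := hf.exists_isVectorGroupExp
  have hscale : ∀ t p, d 1 (f t p) = Real.exp t * d 1 p := fun t p => by
    have := hhom (e t) 1 p
    rwa [map_one] at this
  have hinj := hf.injective hΦ
  have hsurj : Function.Surjective Φ := by
    refine hf.surjective hΦ fun q hq => ?_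
    -- A fixed point satisfies `d 1 q = exp (-1) * d 1 q`, so it lies at distance `0` from the
    -- identity.
    have h1 := hscale (-1) q
    rw [hq] at h1
    have h2 : Real.exp (-1) < 1 := by simp
    have h3 : d 1 q = 0 := by
      have : (1 - Real.exp (-1)) * d 1 q = 0 := by linarith
      exact (mul_eq_zero.1 this).resolve_left (by linarith)
    exact ((hdist.eq_zero_iff 1 q).1 h3).symm
  have hdΦ : ∀ v w, d (Φ v) (Φ w) = d 1 (Φ (w - v)) := fun v w => by
    have := hdist.left_inv (Φ v) 1 (Φ (w - v))
    rwa [mul_one, ← hΦ.map_add, add_sub_cancel] at this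
  have hN : IsFlowHomogeneous (LinearMap.toContinuousLinearMap A') (fun v => d 1 (Φ v)) := by
    refine ⟨fun v => ?_, fun v => ?_, fun v w => ?_, fun t v => ?_⟩
    · rw [hdist.eq_zero_iff, ← hΦ.map_zero, hinj.eq_iff, eq_comm]
    · have := hdΦ v 0
      rw [zero_sub, hΦ.map_zero, hdist.symm] at this
      exact this.symm
    · have h1 := hdist.triangle 1 (Φ v) (Φ (v + w))
      rwa [hdΦ v (v + w), add_sub_cancel_left] at h1
    · rw [← hf.map_exp hΦ, hscale]
  let eqv : E ≃ G := Equiv.ofBijective Φ ⟨hinj, hsurj⟩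
  refine ⟨fun x y => ?_, ⟨eqv, hΦ.contMDiff, hΦ.contMDiff_of_inverse
    (Ψ := eqv.symm) eqv.symm_apply_apply eqv.apply_symm_apply⟩,
    ⟨hΦ.map_zero, fun v => (hΦ.isOneParameterSubgroup v).isMIntegralCurve⟩, hΦ.map_add,
    fun l hl v => hN.map_smul_of_pos hL hl v, hN.toSeminorm hL, fun v => (hN.eq_zero_iff v).1,
    fun v w => ?_⟩
  · obtain ⟨v, rfl⟩ := hsurj x
    obtain ⟨w, rfl⟩ := hsurj y
    rw [← hΦ.map_add, ← hΦ.map_add, add_comm]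
  · rw [← neg_sub w v, map_neg_eq_map]
    exact hdΦ v w
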